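/- Let $M$ be a closed (compact, boundaryless, Hausdorff) smooth manifold, $\mathcal{C}^\infty(M)$ its algebra of smooth complex-valued functions, $\Omega$ its bundle of $1$-densities, $\mathcal{D}'(M)=\mathcal{C}^\infty(M;\Omega)'$ the space of distributions, and $\Psi^{-\infty}(M)$ the Fréchet space of smoothing operators, i.e. of continuous linear operators $\mathcal{D}'(M)\to\mathcal{C}^\infty(M)$. A smooth net $(x_\varepsilon)_{\varepsilon\in(0,1)}$ in a locally convex space is *moderate* if for every continuous seminorm $\rho$ there is $N\in\mathbb{Z}$ with $\rho(x_\varepsilon)=O(\varepsilon^N)$ as $\varepsilon\to0$, and *negligible* if $\rho(x_\varepsilon)=O(\varepsilon^N)$ for every continuous seminorm $\rho$ and every $N\in\mathbb{Z}$. A *moderate approximate unit* is a moderate net $(T_\varepsilon)$ in $\Psi^{-\infty}(M)$ such that $T_\varepsilon u\to u$ in $\mathcal{D}'(M)$ for all $u\in\mathcal{D}'(M)$, and $\rho(T_\varepsilon f-f)=O(\varepsilon^N)$ for all $f\in\mathcal{C}^\infty(M)$, all continuous seminorms $\rho$ on $\mathcal{C}^\infty(M)$ and all $N\in\mathbb{Z}$;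 $\mathcal{U}$ denotes the set of all of them. For $\mathcal{L}\subset\mathcal{U}$ let $E_{\mathcal L}(M)$ be the algebra (under pointwise operations) of Fréchet smooth maps $\phi:\Psi^{-\infty}(M)\to\mathcal{C}^\infty(M)$ such that the net $\phi(T_\varepsilon)$ is moderate for all $(T_\varepsilon)\in\mathcal{L}$, let $N_{\mathcal L}(M)$ be the ideal of those $\phi$ for which $\phi(T_\varepsilon)$ is negligible for all $(T_\varepsilon)\in\mathcal{L}$, and put $\mathcal{G}_{\mathcal L}(M)=E_{\mathcal L}(M)/N_{\mathcal L}(M)$. For $u\in\mathcal{D}'(M)$ let $\Theta_u(T)=T(u)$; then $u\mapsto[\Theta_u]$ is a linear map $\mathcal{D}'(M)\to\mathcal{G}_{\mathcal L}(M)$. For a diffeomorphism $\chi$ of $M$ let $\chi^*$ be the pull back of functions and of distributions, where $\langle\chi^*u,\eta\rangle=\langle u,(\chi^{-1})^*\eta\rangle$. For $T\in\Psi^{-\infty}(M)$ put $\chi_*T=\chi^*\circ T\circ(\chi^{-1})^*$, for a set $X$ of nets put $\chi_*X=\{(\chi_*T_\varepsilon)_\varepsilon : (T_\varepsilon)_\varepsilon\in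 X\}$, and for a map $\phi:\Psi^{-\infty}(M)\to\mathcal{C}^\infty(M)$ put $(\chi^*\phi)(T)=\chi^*\bigl(\phi((\chi_*)^{-1}T)\bigr)$. **Corollary.** Let $X\subset\mathcal{U}$ be a set of moderate approximate units. If $X\neq\emptyset$, then $u\mapsto[\Theta_u]$ is an embedding $\mathcal{D}'(M)\to\mathcal{G}_X(M)$. Moreover: 1. For every diffeomorphism $\chi$ of $M$ one has $\chi_*X\subset\mathcal{U}$, and $\phi\mapsto\chi^*\phi$ maps $E_X(M)$ into $E_{\chi_*X}(M)$ and induces an isomorphism of algebras $\chi^*:\mathcal{G}_X(M)\to\mathcal{G}_{\chi_*X}(M)$, $[\phi]\mapsto[\chi^*\phi]$, with $\chi^*[\Theta_u]=[\Theta_{\chi^*u}]$ for all $u\in\mathcal{D}'(M)$. 2. The diffeomorphisms $\chi$ with $\chi_*X=X$ form a group, which acts on $\mathcal{G}_X(M)$ by the algebra automorphisms $\chi^*[\phi]=[\chi^*\phi]$ (a right action: $\mathrm{id}^*=\mathrm{id}$, $(\psi\circ\chi)^*=\chi^*\circ\psi^*$, $(\chi^{-1})^*=(\chi^*)^{-1}$),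 and the embedding of distributions is equivariant: $\chi^*[\Theta_u]=[\Theta_{\chi^*u}]$. -/

import Mathlib

open Set Filter Topology MeasureTheory
open scoped Manifold ContDiff
set_option linter.unusedSectionVars false
set_option linter.unusedVariables false

namespace GenFun

universe u v

section Nets

variable {X : Type u} [AddCommGroup X] [Module ℂ X] [TopologicalSpace X]

/-- A net indexed by `ε ∈ (0,1)`. -/
abbrev Net (X : Type u) : Type u := Ioo (0 : ℝ) 1 → X

/-- `f ε = O(ε ^ N)` as `ε → 0`. -/
def IsBigOPow (f : Net ℝ) (N : ℤ) : Prop :=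
  ∃ C > (0 : ℝ), ∃ ε₀ > (0 : ℝ), ∀ ε : Ioo (0 : ℝ) 1, (ε : ℝ) < ε₀ → f ε < C * (ε : ℝ) ^ N

/-- `c'` is the derivative of the curve `c` on `(0,1)`: the difference quotients converge in `X`. -/
def HasNetDeriv (c c' : Net X) : Prop :=
  ∀ t : Ioo (0 : ℝ) 1, Tendsto
    (fun s : Ioo (0 : ℝ) 1 => (((s : ℝ) - (t : ℝ) : ℝ) : ℂ)⁻¹ • (c s - c t)) (𝓝[≠] t) (𝓝 (c' t))

/-- The net is `k` times differentiable. -/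
def NetDiff : ℕ → Net X → Prop
  | 0, _ => True
  | k + 1, c => ∃ c' : Net X, HasNetDeriv c c' ∧ NetDiff k c'

/-- Smooth nets: derivatives of all orders exist. -/
def NetSmooth (c : Net X) : Prop := ∀ k, NetDiff k c

/-- For every continuous seminorm `ρ` there is `N` with `ρ (c ε) = O(ε ^ N)`. -/
def HasModerateGrowth (c : Net X) : Prop :=
  ∀ ρ : Seminorm ℂ X, Continuous ρ → ∃ N : ℤ, IsBigOPow (fun ε => ρ (c ε)) N

/-- For every continuous seminorm `ρ` and every `N`, `ρ (c ε) = O(ε ^ N)`. -/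
def HasRapidDecay (c : Net X) : Prop :=
  ∀ ρ : Seminorm ℂ X, Continuous ρ → ∀ N : ℤ, IsBigOPow (fun ε => ρ (c ε)) N

/-- Moderate smooth nets, the elements of `E(X)`. -/
def IsModerate (c : Net X) : Prop := NetSmooth c ∧ HasModerateGrowth c

/-- Negligible smooth nets, the elements of `N(X)`. -/
def IsNegligible (c : Net X) : Prop := NetSmooth c ∧ HasRapidDecay c

end Nets

section Smooth

/-- Maps of class `C^k` between topological vector spaces, regarded as real vector spaces
(Michal, Bastiani, Hamilton, Milnor): `f` is continuous and, for `k ≥ 1`, has directional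
derivatives `df (x, h)` at all points in all directions such that `df` is of class `C^{k-1}` on
`E × E`. -/
def IsFrechetC : (k : ℕ) → {E : Type u} → {F : Type v} →
    [AddCommGroup E] → [Module ℂ E] → [TopologicalSpace E] →
    [AddCommGroup F] → [Module ℂ F] → [TopologicalSpace F] → (E → F) → Prop
  | 0, _, _, _, _, _, _, _, _, f => Continuous f
  | k + 1, E, F, _, _, _, _, _, _, f => Continuous f ∧ ∃ df : E × E → F,
      (∀ x h : E, Tendsto (fun t : ℝ => (t : ℂ)⁻¹ • (f (x + (t : ℂ) • h) - f x))
        (𝓝[≠] 0) (𝓝 (df (x, h)))) ∧ IsFrechetC k df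

/-- Smooth maps between (Fréchet) topological vector spaces. -/
def IsFrechetSmooth {E : Type u} {F : Type v}
    [AddCommGroup E] [Module ℂ E] [TopologicalSpace E]
    [AddCommGroup F] [Module ℂ F] [TopologicalSpace F] (f : E → F) : Prop :=
  ∀ k, IsFrechetC k f

end Smooth

section Calculus

variable {F : Type v} [AddCommGroup F] [Module ℂ F] [TopologicalSpace F]

theorem tendsto_of_quotient [ContinuousAdd F] [ContinuousSMul ℂ F] {α : Type*} {l : Filter α}
    {s : α → ℂ} {d : α → F} {a b : F} (hs : Tendsto s l (𝓝 0)) (hs' : ∀ᶠ t in l, s t ≠ 0)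
    (h : Tendsto (fun t => (s t)⁻¹ • (d t - a)) l (𝓝 b)) : Tendsto d l (𝓝 a) := by
  have h1 := (hs.smul h).add (tendsto_const_nhds (x := a))
  rw [zero_smul, zero_add] at h1
  refine h1.congr' ?_
  filter_upwards [hs'] with t ht
  rw [smul_inv_smul₀ ht, sub_add_cancel]

theorem ofReal_tendsto : Tendsto (fun t : ℝ => (t : ℂ)) (𝓝[≠] 0) (𝓝 0) := by
  have : Tendsto (fun t : ℝ => (t : ℂ)) (𝓝 0) (𝓝 ((0 : ℝ) : ℂ)) :=
    Complex.continuous_ofReal.tendsto 0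
  simpa using this.mono_left nhdsWithin_le_nhds

theorem ofReal_ne : ∀ᶠ t : ℝ in 𝓝[≠] 0, (t : ℂ) ≠ 0 := by
  filter_upwards [self_mem_nhdsWithin] with t ht
  exact_mod_cast ht

theorem sub_tendsto (t : Ioo (0 : ℝ) 1) :
    Tendsto (fun s : Ioo (0 : ℝ) 1 => (((s : ℝ) - (t : ℝ) : ℝ) : ℂ)) (𝓝[≠] t) (𝓝 0) := by
  have : Continuous (fun s : Ioo (0 : ℝ) 1 => (((s : ℝ) - (t : ℝ) : ℝ) : ℂ)) := by fun_prop
  have h := this.tendsto t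
  simp only [sub_self, Complex.ofReal_zero] at h
  exact h.mono_left nhdsWithin_le_nhds

theorem sub_ne (t : Ioo (0 : ℝ) 1) :
    ∀ᶠ s : Ioo (0 : ℝ) 1 in 𝓝[≠] t, (((s : ℝ) - (t : ℝ) : ℝ) : ℂ) ≠ 0 := by
  filter_upwards [self_mem_nhdsWithin] with s hs
  have : (s : ℝ) ≠ t := fun h => hs (Subtype.ext h)
  exact_mod_cast sub_ne_zero.2 this

theorem quotient_mul_tendsto {A : Type v} [CommRing A] [Algebra ℂ A] [TopologicalSpace A]
    [IsTopologicalRing A] [ContinuousSMul ℂ A] {α : Type*} {l : Filter α}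
    {s : α → ℂ} {f g : α → A} {a b f' g' : A} (hs : Tendsto s l (𝓝 0))
    (hs' : ∀ᶠ t in l, s t ≠ 0) (hf : Tendsto (fun t => (s t)⁻¹ • (f t - a)) l (𝓝 f'))
    (hg : Tendsto (fun t => (s t)⁻¹ • (g t - b)) l (𝓝 g')) :
    Tendsto (fun t => (s t)⁻¹ • (f t * g t - a * b)) l (𝓝 (f' * b + a * g')) := by
  have h1 := (hf.mul (tendsto_of_quotient hs hs' hg)).add (hg.const_mul a)
  refine h1.congr fun t => ?_
  rw [smul_mul_assoc, mul_smul_comm, ← smul_add]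
  congr 1
  ring

variable {E : Type u} [AddCommGroup E] [Module ℂ E] [TopologicalSpace E]

theorem IsFrechetC.of_succ (k : ℕ) : ∀ {E : Type u} [AddCommGroup E] [Module ℂ E]
    [TopologicalSpace E] {f : E → F}, IsFrechetC (k + 1) f → IsFrechetC k f := by
  induction k with
  | zero => intro E _ _ _ f h; exact h.1
  | succ k ih =>
    intro E _ _ _ f h
    obtain ⟨hc, df, hd, hk⟩ := h
    exact ⟨hc, df, hd, ih hk⟩

theorem IsFrechetC.comp_clm (k : ℕ) : ∀ {E E' : Type u} [AddCommGroup E] [Module ℂ E]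
    [TopologicalSpace E] [AddCommGroup E'] [Module ℂ E'] [TopologicalSpace E'] {f : E → F}
    (A : E' →L[ℂ] E), IsFrechetC k f → IsFrechetC k (fun x => f (A x)) := by
  induction k with
  | zero => intro E E' _ _ _ _ _ _ f A h; exact Continuous.comp h A.continuous
  | succ k ih =>
    intro E E' _ _ _ _ _ _ f A h
    obtain ⟨hc, df, hd, hk⟩ := h
    refine ⟨hc.comp A.continuous, fun p => df (A.prodMap A p), fun x h => ?_, ih _ hk⟩
    simpa using hd (A x) (A h)

theorem IsFrechetC.const [IsTopologicalAddGroup F] (k : ℕ) : ∀ {E : Type u} [AddCommGroup E]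
    [Module ℂ E] [TopologicalSpace E] (a : F), IsFrechetC k (fun _ : E => a) := by
  induction k with
  | zero => intro E _ _ _ a; exact continuous_const
  | succ k ih =>
    intro E _ _ _ a
    exact ⟨continuous_const, fun _ => 0, fun x h => by simpa using tendsto_const_nhds, ih 0⟩

theorem IsFrechetC.add [IsTopologicalAddGroup F] (k : ℕ) : ∀ {E : Type u} [AddCommGroup E]
    [Module ℂ E] [TopologicalSpace E] {f g : E → F}, IsFrechetC k f → IsFrechetC k g →
    IsFrechetC k (fun x => f x + g x) := by
  induction k with
  | zero => intro E _ _ _ f g hf hg; exact Continuous.add hf hg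
  | succ k ih =>
    intro E _ _ _ f g hf hg
    obtain ⟨hc, df, hd, hk⟩ := hf
    obtain ⟨hc', dg, hd', hk'⟩ := hg
    refine ⟨hc.add hc', _, fun x h => ?_, ih hk hk'⟩
    refine ((hd x h).add (hd' x h)).congr fun t => ?_
    rw [← smul_add, add_sub_add_comm]

theorem IsFrechetC.mul {A : Type v} [CommRing A] [Algebra ℂ A] [TopologicalSpace A]
    [IsTopologicalRing A] [ContinuousSMul ℂ A] (k : ℕ) : ∀ {E : Type u} [AddCommGroup E]
    [Module ℂ E] [TopologicalSpace E] {f g : E → A}, IsFrechetC k f → IsFrechetC k g →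
    IsFrechetC k (fun x => f x * g x) := by
  induction k with
  | zero => intro E _ _ _ f g hf hg; exact Continuous.mul hf hg
  | succ k ih =>
    intro E _ _ _ f g hf hg
    have hf0 := IsFrechetC.comp_clm k (ContinuousLinearMap.fst ℂ E E) (IsFrechetC.of_succ k hf)
    have hg0 := IsFrechetC.comp_clm k (ContinuousLinearMap.fst ℂ E E) (IsFrechetC.of_succ k hg)
    obtain ⟨hc, df, hd, hk⟩ := hf
    obtain ⟨hc', dg, hd', hk'⟩ := hg
    refine ⟨hc.mul hc', _, fun x h => ?_, IsFrechetC.add k (ih hk hg0) (ih hf0 hk')⟩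
    exact quotient_mul_tendsto ofReal_tendsto ofReal_ne (hd x h) (hd' x h)

theorem IsFrechetSmooth.of_clm [IsTopologicalAddGroup F] (A : E →L[ℂ] F) :
    IsFrechetSmooth A := by
  have h0 : ∀ k, ∀ {E : Type u} [AddCommGroup E] [Module ℂ E] [TopologicalSpace E]
      (A : E →L[ℂ] F), IsFrechetC k A := by
    intro k
    induction k with
    | zero => intro E _ _ _ A; exact A.continuous
    | succ k ih =>
      intro E _ _ _ A
      refine ⟨A.continuous, _, fun x h => ?_, ih (A.comp (ContinuousLinearMap.snd ℂ E E))⟩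
      refine (tendsto_const_nhds (x := A h)).congr' ?_
      filter_upwards [ofReal_ne] with t ht
      rw [map_add, add_sub_cancel_left, map_smul, inv_smul_smul₀ ht]
  exact fun k => h0 k A

theorem NetDiff.of_succ (k : ℕ) : ∀ {c : Net F}, NetDiff (k + 1) c → NetDiff k c := by
  induction k with
  | zero => intro c _; trivial
  | succ k ih =>
    rintro c ⟨c', hc, hk⟩
    exact ⟨c', hc, ih hk⟩

theorem NetSmooth.const (a : F) : NetSmooth (fun _ => a : Net F) := by
  have h0 : ∀ k, ∀ a : F, NetDiff k (fun _ => a : Net F) := by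
    intro k
    induction k with
    | zero => intro a; trivial
    | succ k ih =>
      intro a
      exact ⟨fun _ => 0, fun t => by simpa using tendsto_const_nhds, ih 0⟩
  exact fun k => h0 k a

theorem NetDiff.add [IsTopologicalAddGroup F] (k : ℕ) : ∀ {c d : Net F}, NetDiff k c →
    NetDiff k d → NetDiff k (fun ε => c ε + d ε) := by
  induction k with
  | zero => intro c d _ _; trivial
  | succ k ih =>
    rintro c d ⟨c', hc, hk⟩ ⟨d', hd, hk'⟩
    refine ⟨_, fun t => ?_, ih hk hk'⟩
    refine ((hc t).add (hd t)).congr fun s => ?_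
    rw [← smul_add, add_sub_add_comm]

theorem NetDiff.mul {A : Type v} [CommRing A] [Algebra ℂ A] [TopologicalSpace A]
    [IsTopologicalRing A] [ContinuousSMul ℂ A] (k : ℕ) : ∀ {c d : Net A}, NetDiff k c →
    NetDiff k d → NetDiff k (fun ε => c ε * d ε) := by
  induction k with
  | zero => intro c d _ _; trivial
  | succ k ih =>
    intro c d hc hd
    have hc0 := hc.of_succ
    have hd0 := hd.of_succ
    obtain ⟨c', hc, hk⟩ := hc
    obtain ⟨d', hd, hk'⟩ := hd
    refine ⟨_, fun t => ?_, NetDiff.add k (ih hk hd0) (ih hc0 hk')⟩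
    exact quotient_mul_tendsto (sub_tendsto t) (sub_ne t) (hc t) (hd t)

theorem NetSmooth.map_clm (A : E →L[ℂ] F) {c : Net E} (hc : NetSmooth c) :
    NetSmooth (fun ε => A (c ε)) := by
  have h0 : ∀ k, ∀ c : Net E, NetDiff k c → NetDiff k (fun ε => A (c ε)) := by
    intro k
    induction k with
    | zero => intro c _; trivial
    | succ k ih =>
      rintro c ⟨c', hc, hk⟩
      refine ⟨_, fun t => ?_, ih c' hk⟩
      refine ((A.continuous.tendsto _).comp (hc t)).congr fun s => ?_
      simp
  exact fun k => h0 k c (hc k)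

theorem IsBigOPow.mono {f g : Net ℝ} {N : ℤ} (hg : IsBigOPow g N) (h : ∀ ε, f ε ≤ g ε) :
    IsBigOPow f N := by
  obtain ⟨C, hC, e, he, H⟩ := hg
  exact ⟨C, hC, e, he, fun ε hε => (h ε).trans_lt (H ε hε)⟩

theorem IsBigOPow.anti {f : Net ℝ} {N K : ℤ} (hf : IsBigOPow f N) (h : K ≤ N) :
    IsBigOPow f K := by
  obtain ⟨C, hC, e, he, H⟩ := hf
  refine ⟨C, hC, e, he, fun ε hε => (H ε hε).trans_le ?_⟩
  exact mul_le_mul_of_nonneg_left (zpow_le_zpow_right_of_le_one₀ ε.2.1 ε.2.2.le h) hC.le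

theorem IsBigOPow.add {f g : Net ℝ} {N : ℤ} (hf : IsBigOPow f N) (hg : IsBigOPow g N) :
    IsBigOPow (fun ε => f ε + g ε) N := by
  obtain ⟨C, hC, e, he, H⟩ := hf
  obtain ⟨C', hC', e', he', H'⟩ := hg
  refine ⟨C + C', add_pos hC hC', min e e', lt_min he he', fun ε hε => ?_⟩
  have h1 := H ε (hε.trans_le (min_le_left _ _))
  have h2 := H' ε (hε.trans_le (min_le_right _ _))
  rw [add_mul]; exact add_lt_add h1 h2

theorem HasModerateGrowth.const (a : F) : HasModerateGrowth (fun _ => a : Net F) := by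
  intro ρ _
  refine ⟨0, ρ a + 1, by positivity, 1, one_pos, fun ε _ => ?_⟩
  simp

theorem HasModerateGrowth.add {c d : Net F} (hc : HasModerateGrowth c)
    (hd : HasModerateGrowth d) : HasModerateGrowth (fun ε => c ε + d ε) := by
  intro ρ hρ
  obtain ⟨N, hN⟩ := hc ρ hρ
  obtain ⟨K, hK⟩ := hd ρ hρ
  exact ⟨min N K, ((hN.anti (min_le_left _ _)).add (hK.anti (min_le_right _ _))).mono
    fun ε => map_add_le_add ρ _ _⟩

theorem HasRapidDecay.add {c d : Net F} (hc : HasRapidDecay c)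
    (hd : HasRapidDecay d) : HasRapidDecay (fun ε => c ε + d ε) := by
  intro ρ hρ N
  exact ((hc ρ hρ N).add (hd ρ hρ N)).mono fun ε => map_add_le_add ρ _ _

theorem HasModerateGrowth.map_clm (A : E →L[ℂ] F) {c : Net E} (hc : HasModerateGrowth c) :
    HasModerateGrowth (fun ε => A (c ε)) := by
  intro ρ hρ
  exact hc (ρ.comp A.toLinearMap) (hρ.comp A.continuous)

theorem HasRapidDecay.zero : HasRapidDecay (fun _ => 0 : Net F) := by
  intro ρ _ N
  refine ⟨1, one_pos, 1, one_pos, fun ε _ => ?_⟩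
  simpa using zpow_pos ε.2.1 N

/-- The estimates behind the continuity of the multiplication. -/
def HasMulBounds (A : Type v) [CommRing A] [Algebra ℂ A] [TopologicalSpace A] : Prop :=
  ∀ ρ : Seminorm ℂ A, Continuous ρ → ∃ q : Seminorm ℂ A, Continuous q ∧
    ∀ f g : A, ∀ a b : ℝ, q f < a → q g < b → ρ (f * g) < a * b

theorem hasMulBounds {A : Type v} [CommRing A] [Algebra ℂ A] [TopologicalSpace A]
    [IsTopologicalRing A] {ι : Type*} {p : SeminormFamily ℂ A ι} (hp : WithSeminorms p) :
    HasMulBounds A := by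
  intro ρ hρ
  have h1 : {x : A | ρ x < 1} ∈ 𝓝 ((0 : A) * 0) := by
    refine (isOpen_lt hρ continuous_const).mem_nhds ?_
    simp
  have h2 := (continuous_mul (M := A)).continuousAt (x := (0, 0)) h1
  rw [mem_map, nhds_prod_eq, mem_prod_same_iff] at h2
  obtain ⟨U, hU, hUU⟩ := h2
  obtain ⟨s, r, hr, hs⟩ := (hp.mem_nhds_iff 0 U).1 hU
  have hq : Continuous (show Seminorm ℂ A from s.sup p) := Seminorm.continuous_finsetSup fun i _ => hp.continuous_seminorm i
  have hr' : 0 < r⁻¹ := inv_pos.2 hr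
  let c : NNReal := ⟨r⁻¹, hr'.le⟩
  refine ⟨c • (show Seminorm ℂ A from s.sup p), hq.const_smul c, fun f g a b hf hg => ?_⟩
  have hf' : r⁻¹ * (s.sup p) f < a := hf
  have hg' : r⁻¹ * (s.sup p) g < b := hg
  have ha : 0 < a := (mul_nonneg hr'.le (apply_nonneg _ _)).trans_lt hf'
  have hb : 0 < b := (mul_nonneg hr'.le (apply_nonneg _ _)).trans_lt hg'
  have key : ∀ (x : A) (c : ℝ), 0 < c → r⁻¹ * (s.sup p) x < c → ((c⁻¹ : ℝ) : ℂ) • x ∈ U := by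
    intro x c hc hx
    apply hs
    rw [Seminorm.mem_ball_zero, map_smul_eq_mul, Complex.norm_real, Real.norm_eq_abs,
      abs_of_pos (inv_pos.2 hc)]
    rw [inv_mul_lt_iff₀ hr] at hx
    rw [inv_mul_lt_iff₀ hc, mul_comm]; exact hx
  have h3 : ρ ((((a⁻¹ : ℝ) : ℂ) • f) * (((b⁻¹ : ℝ) : ℂ) • g)) < 1 :=
    hUU (mk_mem_prod (key f a ha hf') (key g b hb hg'))
  rw [smul_mul_smul_comm, map_smul_eq_mul, norm_mul, Complex.norm_real, Complex.norm_real,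
    Real.norm_eq_abs, Real.norm_eq_abs, abs_of_pos (inv_pos.2 ha), abs_of_pos (inv_pos.2 hb),
    ← mul_inv, inv_mul_lt_iff₀ (mul_pos ha hb), mul_one] at h3
  exact h3

theorem bigO_mul {A : Type v} [CommRing A] [Algebra ℂ A] {q ρ : Seminorm ℂ A}
    (h : ∀ f g : A, ∀ a b : ℝ, q f < a → q g < b → ρ (f * g) < a * b) {c d : Net A} {N K : ℤ}
    (hc : IsBigOPow (fun ε => q (c ε)) N) (hd : IsBigOPow (fun ε => q (d ε)) K) :
    IsBigOPow (fun ε => ρ (c ε * d ε)) (N + K) := by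
  obtain ⟨C, hC, e, he, H⟩ := hc
  obtain ⟨C', hC', e', he', H'⟩ := hd
  refine ⟨C * C', mul_pos hC hC', min e e', lt_min he he', fun ε hε => ?_⟩
  have h1 := H ε (hε.trans_le (min_le_left _ _))
  have h2 := H' ε (hε.trans_le (min_le_right _ _))
  refine (h _ _ _ _ h1 h2).trans_eq ?_
  rw [zpow_add₀ ε.2.1.ne']; ring

theorem HasModerateGrowth.mul {A : Type v} [CommRing A] [Algebra ℂ A] [TopologicalSpace A]
    (hA : HasMulBounds A) {c d : Net A} (hc : HasModerateGrowth c) (hd : HasModerateGrowth d) :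
    HasModerateGrowth (fun ε => c ε * d ε) := by
  intro ρ hρ
  obtain ⟨q, hq, h⟩ := hA ρ hρ
  obtain ⟨N, hN⟩ := hc q hq
  obtain ⟨K, hK⟩ := hd q hq
  exact ⟨N + K, bigO_mul h hN hK⟩

theorem HasRapidDecay.mul {A : Type v} [CommRing A] [Algebra ℂ A] [TopologicalSpace A]
    (hA : HasMulBounds A) {c d : Net A} (hc : HasModerateGrowth c) (hd : HasRapidDecay d) :
    HasRapidDecay (fun ε => c ε * d ε) := by
  intro ρ hρ K
  obtain ⟨q, hq, h⟩ := hA ρ hρ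
  obtain ⟨N, hN⟩ := hc q hq
  simpa using bigO_mul h hN (hd q hq (K - N))

end Calculus

section Manifold

/-- The model space `ℝ^n`. -/
abbrev Model (n : ℕ) : Type := EuclideanSpace ℝ (Fin n)

variable (n : ℕ) (M : Type u) [TopologicalSpace M] [ChartedSpace (Model n) M]

/-- The charts of the smooth structure of `M`, that is, of its maximal `C^∞` atlas. -/
abbrev Chart : Type u :=
  {e : OpenPartialHomeomorph M (Model n) // e ∈ IsManifold.maximalAtlas (𝓡 n) ∞ M}

/-- Index set of the seminorms `sup_K ‖D^k‖`: a chart, a compact subset `K` of its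
image, and an order `k` of differentiation. -/
structure JetIndex : Type u where
  chart : Chart n M
  K : Set (Model n)
  isCompact : IsCompact K
  subset : K ⊆ chart.1.target
  order : ℕ

variable {n M}

/-- The seminorm `v ↦ sup_{y ∈ K} ‖D^k (R e v) (y)‖`, where `R e v` is the function that represents
`v` in the chart `e`. -/
noncomputable def jetSeminorm {V : Type v} [AddCommGroup V] [Module ℂ V]
    (R : Chart n M → V →ₗ[ℂ] (Model n → ℂ))
    (hR : ∀ e v, ContDiffOn ℝ ∞ (R e v) e.1.target) (i : JetIndex n M) : Seminorm ℂ V :=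
  have bdd : ∀ v : V, BddAbove (range fun y : i.K =>
      ‖iteratedFDerivWithin ℝ i.order (R i.chart v) i.chart.1.target y‖) := by
    intro v
    have hc := ((hR i.chart v).continuousOn_iteratedFDerivWithin
      (m := i.order) (by exact_mod_cast le_top) i.chart.1.open_target.uniqueDiffOn).mono i.subset
    have := i.isCompact.bddAbove_image hc.norm
    rwa [image_eq_range] at this
  Seminorm.of
    (fun v => ⨆ y : i.K, ‖iteratedFDerivWithin ℝ i.order (R i.chart v) i.chart.1.target y‖)
    (by
      intro v w
      refine Real.iSup_le (fun y => ?_) (add_nonneg (Real.iSup_nonneg fun _ => norm_nonneg _)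
        (Real.iSup_nonneg fun _ => norm_nonneg _))
      have hy := i.subset y.2
      have h : iteratedFDerivWithin ℝ i.order (R i.chart (v + w)) i.chart.1.target y =
          iteratedFDerivWithin ℝ i.order (R i.chart v) i.chart.1.target y +
          iteratedFDerivWithin ℝ i.order (R i.chart w) i.chart.1.target y := by
        rw [map_add]
        exact iteratedFDerivWithin_add_apply
          (((hR i.chart v) _ hy).of_le (by exact_mod_cast le_top))
          (((hR i.chart w) _ hy).of_le (by exact_mod_cast le_top))
          i.chart.1.open_target.uniqueDiffOn hy
      rw [h]
      exact (norm_add_le _ _).trans (add_le_add (le_ciSup (bdd v) y) (le_ciSup (bdd w) y)))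
    (by
      intro a v
      rw [Real.mul_iSup_of_nonneg (norm_nonneg a)]
      congr 1; ext y
      have hy := i.subset y.2
      rw [map_smul, iteratedFDerivWithin_const_smul_apply
          (((hR i.chart v) _ hy).of_le (by exact_mod_cast le_top))
          i.chart.1.open_target.uniqueDiffOn hy, norm_smul])


variable (n M)

/-- The complex algebra `C^∞(M)` of smooth complex-valued functions. -/
noncomputable def smoothSubalgebra : Subalgebra ℂ (M → ℂ) where
  carrier := {f | ContMDiff (𝓡 n) 𝓘(ℝ, ℂ) ∞ f}
  mul_mem' hf hg := (contDiff_mul (𝕜 := ℝ) (𝔸 := ℂ)).contMDiff.comp (hf.prodMk_space hg)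
  add_mem' hf hg := ContMDiff.add hf hg
  algebraMap_mem' _ := contMDiff_const

/-- The algebra `C^∞(M)` of smooth complex-valued functions; it gets the topology of uniform
convergence of all derivatives on compact subsets of charts (not a subspace topology of `M → ℂ`). -/
def SmoothFun : Type u := smoothSubalgebra n M

noncomputable instance : CommRing (SmoothFun n M) := inferInstanceAs (CommRing (smoothSubalgebra n M))

noncomputable instance : Algebra ℂ (SmoothFun n M) :=
  inferInstanceAs (Algebra ℂ (smoothSubalgebra n M))

instance : CoeFun (SmoothFun n M) (fun _ => M → ℂ) := ⟨fun f => f.1⟩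

variable {n M}

/-- The function `f ∘ e⁻¹` that represents `f` in the chart `e`. -/
noncomputable def SmoothFun.rep (e : Chart n M) : SmoothFun n M →ₗ[ℂ] (Model n → ℂ) where
  toFun f := fun y => f (e.1.symm y)
  map_add' _ _ := rfl
  map_smul' _ _ := rfl

theorem SmoothFun.rep_contDiffOn [IsManifold (𝓡 n) ∞ M] (e : Chart n M) (f : SmoothFun n M) :
    ContDiffOn ℝ ∞ (SmoothFun.rep e f) e.1.target := by
  have h := (show ContMDiff (𝓡 n) 𝓘(ℝ, ℂ) ∞ f.1 from f.2).comp_contMDiffOn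
    (contMDiffOn_symm_of_mem_maximalAtlas e.2)
  exact contMDiffOn_iff_contDiffOn.1 h

variable (n M)

/-- Smooth sections of the (complexified) bundle `Ω` of `1`-densities, given by their coefficients
`η e` with respect to `|dy¹ ⋯ dyⁿ|` in all charts `e`. The coefficient is a smooth function on the
image of `e` (extended by zero, so that it is determined by its values there), and coefficients in
two charts are related by the absolute value of the Jacobian determinant of the transition map. -/
def densitySubmodule : Submodule ℂ (Chart n M → Model n → ℂ) where
  carrier := {η | (∀ e, ContDiffOn ℝ ∞ (η e) e.1.target) ∧ (∀ e, ∀ y ∉ e.1.target, η e y = 0) ∧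
    ∀ e e' : Chart n M, ∀ y ∈ (e.1.symm.trans e'.1).source,
      η e y = |(fderiv ℝ (e.1.symm.trans e'.1) y).det| * η e' (e.1.symm.trans e'.1 y)}
  zero_mem' := ⟨fun _ => contDiffOn_const, fun _ _ _ => rfl, fun _ _ _ _ => by simp⟩
  add_mem' := by
    rintro a b ⟨ha, ha', ha''⟩ ⟨hb, hb', hb''⟩
    refine ⟨fun e => (ha e).add (hb e), fun e y hy => ?_, fun e e' y hy => ?_⟩
    · simp [ha' e y hy, hb' e y hy]
    · simp only [Pi.add_apply]
      rw [ha'' e e' y hy, hb'' e e' y hy, mul_add]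
  smul_mem' := by
    rintro c a ⟨ha, ha', ha''⟩
    refine ⟨fun e => (ha e).const_smul c, fun e y hy => ?_, fun e e' y hy => ?_⟩
    · simp [ha' e y hy]
    · simp only [Pi.smul_apply, smul_eq_mul]
      rw [ha'' e e' y hy]; ring

/-- The space `C^∞(M; Ω)` of smooth `1`-densities, with the `C^∞` topology. -/
def Density : Type u := densitySubmodule n M

noncomputable instance : AddCommGroup (Density n M) :=
  inferInstanceAs (AddCommGroup (densitySubmodule n M))

noncomputable instance : Module ℂ (Density n M) :=
  inferInstanceAs (Module ℂ (densitySubmodule n M))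

variable {n M}

def Density.rep (e : Chart n M) : Density n M →ₗ[ℂ] (Model n → ℂ) where
  toFun η := η.1 e
  map_add' _ _ := rfl
  map_smul' _ _ := rfl

theorem Density.rep_contDiffOn (e : Chart n M) (η : Density n M) :
    ContDiffOn ℝ ∞ (Density.rep e η) e.1.target := η.2.1 e

variable (n M)
variable [IsManifold (𝓡 n) ∞ M]

/-- The seminorms that define the topology of `C^∞(M)`. -/
noncomputable def smoothFamily : SeminormFamily ℂ (SmoothFun n M) (JetIndex n M) :=
  jetSeminorm SmoothFun.rep SmoothFun.rep_contDiffOn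

/-- The seminorms that define the topology of `C^∞(M; Ω)`. -/
noncomputable def densityFamily : SeminormFamily ℂ (Density n M) (JetIndex n M) :=
  jetSeminorm Density.rep Density.rep_contDiffOn

noncomputable instance : TopologicalSpace (SmoothFun n M) :=
  (smoothFamily n M).moduleFilterBasis.topology

noncomputable instance : TopologicalSpace (Density n M) :=
  (densityFamily n M).moduleFilterBasis.topology

theorem smooth_withSeminorms : WithSeminorms (smoothFamily n M) := ⟨rfl⟩

theorem density_withSeminorms : WithSeminorms (densityFamily n M) := ⟨rfl⟩

instance : IsTopologicalAddGroup (SmoothFun n M) := (smooth_withSeminorms n M).topologicalAddGroup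
instance : ContinuousSMul ℂ (SmoothFun n M) := (smooth_withSeminorms n M).continuousSMul
instance : IsTopologicalAddGroup (Density n M) := (density_withSeminorms n M).topologicalAddGroup
instance : ContinuousSMul ℂ (Density n M) := (density_withSeminorms n M).continuousSMul

theorem smoothFamily_mul_le (i : JetIndex n M) (f g : SmoothFun n M) :
    smoothFamily n M i (f * g) ≤ ∑ j ∈ Finset.range (i.order + 1), (i.order.choose j : ℝ) *
      smoothFamily n M { i with order := j } f *
      smoothFamily n M { i with order := i.order - j } g := by
  have bdd : ∀ (k : ℕ) (v : SmoothFun n M), BddAbove (range fun y : i.K =>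
      ‖iteratedFDerivWithin ℝ k (SmoothFun.rep i.chart v) i.chart.1.target y‖) := by
    intro k v
    have hc := ((SmoothFun.rep_contDiffOn i.chart v).continuousOn_iteratedFDerivWithin
      (m := k) (by exact_mod_cast le_top) i.chart.1.open_target.uniqueDiffOn).mono i.subset
    have := i.isCompact.bddAbove_image hc.norm
    rwa [image_eq_range] at this
  refine Real.iSup_le (fun y => ?_) (Finset.sum_nonneg fun j _ =>
    mul_nonneg (mul_nonneg (Nat.cast_nonneg _) (apply_nonneg _ _)) (apply_nonneg _ _))
  have h := norm_iteratedFDerivWithin_mul_le (SmoothFun.rep_contDiffOn i.chart f)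
    (SmoothFun.rep_contDiffOn i.chart g) i.chart.1.open_target.uniqueDiffOn (i.subset y.2)
    (n := i.order) (by exact_mod_cast le_top)
  refine h.trans (Finset.sum_le_sum fun j _ => ?_)
  have h1 := le_ciSup (bdd j f) y
  have h2 := le_ciSup (bdd (i.order - j) g) y
  exact mul_le_mul (mul_le_mul_of_nonneg_left h1 (Nat.cast_nonneg _)) h2 (norm_nonneg _)
    (mul_nonneg (Nat.cast_nonneg _) (apply_nonneg (smoothFamily n M { i with order := j }) f))

instance : IsTopologicalRing (SmoothFun n M) := by
  have hp := smooth_withSeminorms n M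
  have hc : ∀ i, Tendsto (smoothFamily n M i) (𝓝 0) (𝓝 0) := fun i => by
    simpa using (hp.continuous_seminorm i).tendsto 0
  have hl : ∀ f : SmoothFun n M, Tendsto (fun x => f * x) (𝓝 0) (𝓝 0) := by
    intro f
    rw [hp.tendsto_nhds]
    intro i ε hε
    have h1 : Tendsto (fun x : SmoothFun n M =>
        ∑ j ∈ Finset.range (i.order + 1), (i.order.choose j : ℝ) *
        smoothFamily n M { i with order := j } f *
        smoothFamily n M { i with order := i.order - j } x) (𝓝 0) (𝓝 0) := by
      have : Tendsto (fun x : SmoothFun n M =>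
        ∑ j ∈ Finset.range (i.order + 1), (i.order.choose j : ℝ) *
        smoothFamily n M { i with order := j } f *
        smoothFamily n M { i with order := i.order - j } x) (𝓝 0)
          (𝓝 (∑ j ∈ Finset.range (i.order + 1), (i.order.choose j : ℝ) *
            smoothFamily n M { i with order := j } f * 0)) :=
        tendsto_finsetSum _ fun j _ => (hc _).const_mul _
      simpa using this
    filter_upwards [h1.eventually (gt_mem_nhds hε)] with x hx
    rw [sub_zero]
    exact (smoothFamily_mul_le n M i f x).trans_lt hx
  refine IsTopologicalRing.of_addGroup_of_nhds_zero ?_ ?_ ?_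
  · rw [hp.tendsto_nhds]
    intro i ε hε
    have h1 : Tendsto (fun x : SmoothFun n M × SmoothFun n M =>
        ∑ j ∈ Finset.range (i.order + 1), (i.order.choose j : ℝ) *
        smoothFamily n M { i with order := j } x.1 *
        smoothFamily n M { i with order := i.order - j } x.2) (𝓝 0 ×ˢ 𝓝 0) (𝓝 0) := by
      have : Tendsto (fun x : SmoothFun n M × SmoothFun n M =>
        ∑ j ∈ Finset.range (i.order + 1), (i.order.choose j : ℝ) *
        smoothFamily n M { i with order := j } x.1 *
        smoothFamily n M { i with order := i.order - j } x.2) (𝓝 0 ×ˢ 𝓝 0)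
          (𝓝 (∑ j ∈ Finset.range (i.order + 1), (i.order.choose j : ℝ) * 0 * 0)) :=
        tendsto_finsetSum _ fun j _ => (((hc _).comp tendsto_fst).const_mul _).mul
          ((hc _).comp tendsto_snd)
      simpa using this
    filter_upwards [h1.eventually (gt_mem_nhds hε)] with x hx
    rw [sub_zero]
    exact (smoothFamily_mul_le n M i x.1 x.2).trans_lt hx
  · exact hl
  · intro f
    simpa only [mul_comm] using hl f

/-- The space `D'(M)` of distributions, the strong dual of `C^∞(M; Ω)`. -/
abbrev Distribution : Type u := Density n M →L[ℂ] ℂ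

/-- The space `Ψ^{-∞}(M)` of smoothing operators: continuous linear operators `D'(M) → C^∞(M)`, with
the topology of uniform convergence on bounded subsets of `D'(M)`. By the Schwartz kernel theorem
this is the Fréchet topology of the space of smooth kernels `Γ(M × M; π₂^* Ω)`. -/
abbrev SmoothingOp : Type u := Distribution n M →L[ℂ] SmoothFun n M

variable {n M}

/-- The chart `e ∘ χ`. -/
noncomputable def Chart.pull (χ : M ≃ₘ^∞⟮𝓡 n, 𝓡 n⟯ M) (e : Chart n M) : Chart n M :=
  ⟨χ.toHomeomorph.transOpenPartialHomeomorph e.1, by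
    rw [IsManifold.mem_maximalAtlas_iff_contMDiffOn]
    constructor
    · exact (contMDiffOn_of_mem_maximalAtlas e.2).comp χ.contMDiff.contMDiffOn (fun x hx => hx)
    · exact χ.symm.contMDiff.comp_contMDiffOn (contMDiffOn_symm_of_mem_maximalAtlas e.2)⟩

theorem continuous_of_rep_eq {V : Type v} [AddCommGroup V] [Module ℂ V] [TopologicalSpace V]
    {R : Chart n M → V →ₗ[ℂ] (Model n → ℂ)}
    {hR : ∀ e v, ContDiffOn ℝ ∞ (R e v) e.1.target}
    (hV : WithSeminorms (jetSeminorm R hR)) (χ : M ≃ₘ^∞⟮𝓡 n, 𝓡 n⟯ M) (A : V →ₗ[ℂ] V)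
    (hA : ∀ e v, R e (A v) = R (e.pull χ.symm) v) : Continuous A := by
  refine WithSeminorms.continuous_of_isBounded hV hV A fun i => ?_
  refine ⟨{⟨i.chart.pull χ.symm, i.K, i.isCompact, i.subset, i.order⟩}, 1, ?_⟩
  intro v
  simp only [Finset.sup_singleton, one_smul, Seminorm.comp_apply]
  change (⨆ y : i.K, ‖iteratedFDerivWithin ℝ i.order (R i.chart (A v)) i.chart.1.target y‖) ≤
    (⨆ y : i.K, ‖iteratedFDerivWithin ℝ i.order (R (i.chart.pull χ.symm) v)
      i.chart.1.target y‖)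
  rw [hA]

/-- The pull back `χ^* f = f ∘ χ` of smooth functions. -/
noncomputable def pullFun (χ : M ≃ₘ^∞⟮𝓡 n, 𝓡 n⟯ M) : SmoothFun n M →L[ℂ] SmoothFun n M where
  toFun f := ⟨fun x => f (χ x), (show ContMDiff (𝓡 n) 𝓘(ℝ, ℂ) ∞ f.1 from f.2).comp χ.contMDiff⟩
  map_add' _ _ := rfl
  map_smul' _ _ := rfl
  cont := continuous_of_rep_eq (smooth_withSeminorms n M) χ
    { toFun := fun f => (⟨fun x => f (χ x),
        (show ContMDiff (𝓡 n) 𝓘(ℝ, ℂ) ∞ f.1 from f.2).comp χ.contMDiff⟩ : SmoothFun n M)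
      map_add' := fun _ _ => rfl
      map_smul' := fun _ _ => rfl } (fun _ _ => rfl)

theorem Density.pull_aux (χ : M ≃ₘ^∞⟮𝓡 n, 𝓡 n⟯ M) (η : Density n M) :
    (fun e : Chart n M => η.1 (e.pull χ.symm)) ∈ densitySubmodule n M := by
  refine ⟨fun e => η.2.1 (e.pull χ.symm), fun e => η.2.2.1 (e.pull χ.symm), fun e e' y hy => ?_⟩
  have key : ((e.pull χ.symm).1.symm.trans (e'.pull χ.symm).1 : Model n → Model n)
      = e.1.symm.trans e'.1 := by
    funext z
    change e'.1 (χ.symm (χ (e.1.symm z))) = e'.1 (e.1.symm z)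
    rw [χ.symm_apply_apply]
  have hy' : y ∈ ((e.pull χ.symm).1.symm.trans (e'.pull χ.symm).1).source := by
    refine ⟨hy.1, ?_⟩
    change χ.symm (χ (e.1.symm y)) ∈ e'.1.source
    rw [χ.symm_apply_apply]
    exact hy.2
  have h := η.2.2.2 (e.pull χ.symm) (e'.pull χ.symm) y hy'
  rw [key] at h
  exact h

/-- The pull back `χ^* η` of densities: its coefficient in the chart `e` is the coefficient of `η` in
the chart `e ∘ χ⁻¹`. -/
noncomputable def pullDensity (χ : M ≃ₘ^∞⟮𝓡 n, 𝓡 n⟯ M) : Density n M →L[ℂ] Density n M where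
  toFun η := ⟨fun e => η.1 (e.pull χ.symm), Density.pull_aux χ η⟩
  map_add' _ _ := rfl
  map_smul' _ _ := rfl
  cont := continuous_of_rep_eq (density_withSeminorms n M) χ
    { toFun := fun η => (⟨fun e => η.1 (e.pull χ.symm), Density.pull_aux χ η⟩ : Density n M)
      map_add' := fun _ _ => rfl
      map_smul' := fun _ _ => rfl } (fun _ _ => rfl)

/-- The pull back of distributions, `⟨χ^* u, η⟩ = ⟨u, (χ⁻¹)^* η⟩`. -/
noncomputable def pullDist (χ : M ≃ₘ^∞⟮𝓡 n, 𝓡 n⟯ M) : Distribution n M →L[ℂ] Distribution n M :=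
  ContinuousLinearMap.precomp ℂ (pullDensity χ.symm)

/-- The action of a diffeomorphism on smoothing operators, `χ_* T = χ^* ∘ T ∘ (χ⁻¹)^*`. -/
noncomputable def pushOp (χ : M ≃ₘ^∞⟮𝓡 n, 𝓡 n⟯ M) (T : SmoothingOp n M) : SmoothingOp n M :=
  (pullFun χ).comp (T.comp (pullDist χ.symm))


section Integral

variable [T2Space M] [CompactSpace M]

variable (n M)

/-- A smooth partition of unity subordinate to the charts `chartAt x`, `x ∈ M`. -/
noncomputable def chosenPartition : SmoothPartitionOfUnity M (𝓡 n) M univ :=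
  (SmoothPartitionOfUnity.exists_isSubordinate_chartAt_source (𝓡 n) M).choose

theorem chosenPartition_subordinate :
    (chosenPartition n M).IsSubordinate (fun x => (chartAt (Model n) x).source) :=
  (SmoothPartitionOfUnity.exists_isSubordinate_chartAt_source (𝓡 n) M).choose_spec

variable {n M}

/-- The preferred chart at `x`. -/
noncomputable def chartAtlas (x : M) : Chart n M :=
  ⟨chartAt (Model n) x, IsManifold.chart_mem_maximalAtlas x⟩

/-- The integral of `ρ_x f η`, in the chart at `x`, for the member `ρ_x` of the partition of unity. -/
noncomputable def integralTerm (f : SmoothFun n M) (η : Density n M) (x : M) : ℂ :=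
  ∫ y in (chartAtlas (n := n) x).1.target,
    ((chosenPartition n M x ((chartAtlas (n := n) x).1.symm y) : ℝ) : ℂ) *
      (f ((chartAtlas (n := n) x).1.symm y) * η.1 (chartAtlas x) y)

/-- The integral `∫_M f η` of the density `f η`. -/
noncomputable def integralMul (f : SmoothFun n M) (η : Density n M) : ℂ :=
  ∑ᶠ x : M, integralTerm f η x

/-- The compact image of the support of `ρ_x` in the chart at `x`. -/
noncomputable def supportIndex (x : M) : JetIndex n M where
  chart := chartAtlas x
  K := (chartAtlas (n := n) x).1 '' tsupport (chosenPartition n M x)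
  isCompact := (isClosed_tsupport _).isCompact.image_of_continuousOn
    ((chartAtlas (n := n) x).1.continuousOn.mono (chosenPartition_subordinate n M x))
  subset := by
    rintro _ ⟨z, hz, rfl⟩
    exact (chartAtlas (n := n) x).1.map_source (chosenPartition_subordinate n M x hz)
  order := 0

theorem integralTerm_eq (f : SmoothFun n M) (η : Density n M) (x : M) :
    integralTerm f η x = ∫ y in (supportIndex (n := n) x).K,
    ((chosenPartition n M x ((chartAtlas (n := n) x).1.symm y) : ℝ) : ℂ) *
      (f ((chartAtlas (n := n) x).1.symm y) * η.1 (chartAtlas x) y) := by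
  refine setIntegral_eq_of_subset_of_forall_sdiff_eq_zero
    (chartAtlas (n := n) x).1.open_target.measurableSet (supportIndex x).subset ?_
  rintro y ⟨hy, hy'⟩
  have : chosenPartition n M x ((chartAtlas (n := n) x).1.symm y) = 0 := by
    by_contra h
    exact hy' ⟨_, subset_tsupport _ h, (chartAtlas (n := n) x).1.right_inv hy⟩
  simp [this]

theorem continuousOn_weight (f : SmoothFun n M) (x : M) : ContinuousOn (fun y =>
    ((chosenPartition n M x ((chartAtlas (n := n) x).1.symm y) : ℝ) : ℂ) *
      f ((chartAtlas (n := n) x).1.symm y)) (supportIndex (n := n) x).K := by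
  have h1 : ContinuousOn (chartAtlas (n := n) x).1.symm (supportIndex (n := n) x).K :=
    (chartAtlas (n := n) x).1.continuousOn_symm.mono (supportIndex x).subset
  have h2 : Continuous f.1 := (show ContMDiff (𝓡 n) 𝓘(ℝ, ℂ) ∞ f.1 from f.2).continuous
  exact (Complex.continuous_ofReal.comp_continuousOn
    ((chosenPartition n M x).contMDiff.continuous.comp_continuousOn h1)).mul (h2.comp_continuousOn h1)

theorem continuousOn_coeff (η : Density n M) (x : M) :
    ContinuousOn (η.1 (chartAtlas x)) (supportIndex (n := n) x).K :=
  (η.2.1 (chartAtlas x)).continuousOn.mono (supportIndex x).subset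

theorem integrableOn_term (f : SmoothFun n M) (η : Density n M) (x : M) : IntegrableOn (fun y =>
    ((chosenPartition n M x ((chartAtlas (n := n) x).1.symm y) : ℝ) : ℂ) *
      (f ((chartAtlas (n := n) x).1.symm y) * η.1 (chartAtlas x) y))
      (supportIndex (n := n) x).K := by
  refine ContinuousOn.integrableOn_compact (supportIndex x).isCompact ?_
  exact ((continuousOn_weight f x).mul (continuousOn_coeff η x)).congr fun y _ => (mul_assoc _ _ _).symm

noncomputable def termLinear (f : SmoothFun n M) (x : M) : Density n M →ₗ[ℂ] ℂ where
  toFun η := integralTerm f η x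
  map_add' a b := by
    rw [integralTerm_eq, integralTerm_eq, integralTerm_eq,
      ← integral_add (integrableOn_term f a x) (integrableOn_term f b x)]
    congr 1; ext y
    change _ * (_ * (a.1 _ y + b.1 _ y)) = _
    ring
  map_smul' c a := by
    rw [integralTerm_eq, integralTerm_eq, RingHom.id_apply, smul_eq_mul, ← integral_const_mul]
    congr 1; ext y
    change _ * (_ * (c * a.1 _ y)) = _
    ring

theorem continuous_term (f : SmoothFun n M) (x : M) : Continuous (termLinear f x) := by
  obtain ⟨C, hC⟩ := (supportIndex x).isCompact.exists_bound_of_continuousOn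
    (continuousOn_weight f x)
  set V := volume.real (supportIndex (n := n) x).K
  refine WithSeminorms.continuous_normedSpace_rng ℂ (density_withSeminorms n M) _
    ⟨{supportIndex x}, Real.toNNReal (|C| * V), fun η => ?_⟩
  simp only [Finset.sup_singleton]
  change ‖integralTerm f η x‖ ≤ ((Real.toNNReal (|C| * V) : NNReal) : ℝ) *
    densityFamily n M (supportIndex x) η
  rw [Real.coe_toNNReal _ (mul_nonneg (abs_nonneg _) measureReal_nonneg), integralTerm_eq]
  have hb : ∀ y ∈ (supportIndex (n := n) x).K, ‖η.1 (chartAtlas x) y‖ ≤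
      densityFamily n M (supportIndex x) η := by
    intro y hy
    have hbd : BddAbove (range fun y : (supportIndex (n := n) x).K =>
        ‖iteratedFDerivWithin ℝ 0 (η.1 (chartAtlas x)) (chartAtlas (n := n) x).1.target y‖) := by
      have := (supportIndex x).isCompact.bddAbove_image (continuousOn_coeff η x).norm
      rw [image_eq_range] at this
      simpa only [norm_iteratedFDerivWithin_zero] using this
    have := le_ciSup hbd ⟨y, hy⟩
    rw [norm_iteratedFDerivWithin_zero] at this
    exact this
  refine (norm_setIntegral_le_of_norm_le_const (C := |C| * densityFamily n M (supportIndex x) η)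
    (supportIndex x).isCompact.measure_lt_top fun y hy => ?_).trans (le_of_eq (by ring))
  rw [← mul_assoc, norm_mul]
  exact mul_le_mul ((hC y hy).trans (le_abs_self C)) (hb y hy) (norm_nonneg _) (abs_nonneg _)

variable (n M) in
theorem finite_partition : {x : M | (Function.support (chosenPartition n M x)).Nonempty}.Finite :=
  (chosenPartition n M).locallyFinite.finite_nonempty_of_compact

theorem integralMul_eq (f : SmoothFun n M) (η : Density n M) :
    integralMul f η = ∑ x ∈ (finite_partition n M).toFinset, termLinear f x η := by
  refine finsum_eq_sum_of_support_subset _ fun x hx => ?_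
  simp only [Finite.coe_toFinset, mem_ofPred_eq]
  by_contra h
  rw [Function.support_nonempty_iff, not_not] at h
  apply hx
  simp [integralTerm, h]

/-- A smooth function as a distribution, `η ↦ ∫_M f η`. -/
noncomputable def SmoothFun.toDist (f : SmoothFun n M) : Distribution n M where
  toFun η := integralMul f η
  map_add' a b := by simp only [integralMul_eq, map_add, Finset.sum_add_distrib]
  map_smul' c a := by simp only [integralMul_eq, map_smul, Finset.smul_sum, RingHom.id_apply]
  cont := by
    simp only [integralMul_eq]
    exact continuous_finsetSum _ fun x _ => continuous_term f x

/-- Moderate approximate units: moderate nets of smoothing operators with `T_ε u → u` in `D'(M)` for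
all distributions `u`, and `T_ε f → f` rapidly in `C^∞(M)` for all smooth functions `f`. -/
structure IsApproxUnit (T : Net (SmoothingOp n M)) : Prop where
  moderate : IsModerate T
  tendsto : ∀ (u : Distribution n M) (η : Density n M),
    Tendsto (fun ε : Ioo (0 : ℝ) 1 => (T ε u).toDist η) (comap Subtype.val (𝓝 0)) (𝓝 (u η))
  rapid : ∀ f : SmoothFun n M, HasRapidDecay (fun ε => T ε f.toDist - f)



variable (n M)

/-- The set `𝒰(M)` of moderate approximate units. -/
def approxUnits : Set (Net (SmoothingOp n M)) := {T | IsApproxUnit T}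

theorem smooth_hasMulBounds : HasMulBounds (SmoothFun n M) :=
  hasMulBounds (smooth_withSeminorms n M)

variable {n M}

/-- The set `χ_* L = {(χ_* T_ε)_ε | (T_ε)_ε ∈ L}`. -/
def pushSet (χ : M ≃ₘ^∞⟮𝓡 n, 𝓡 n⟯ M) (L : Set (Net (SmoothingOp n M))) :
    Set (Net (SmoothingOp n M)) :=
  (fun T : Net (SmoothingOp n M) => fun ε => pushOp χ (T ε)) '' L

/-- The algebra `E_L(M)` of smooth maps `Ψ^{-∞}(M) → C^∞(M)` that are moderate over `L`. -/
def moderateMaps (L : Set (Net (SmoothingOp n M))) :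
    Subalgebra ℂ (SmoothingOp n M → SmoothFun n M) where
  carrier := {φ | IsFrechetSmooth φ ∧ ∀ T ∈ L, IsModerate (fun ε => φ (T ε))}
  mul_mem' hf hg := ⟨fun k => IsFrechetC.mul k (hf.1 k) (hg.1 k), fun T hT =>
    ⟨fun k => NetDiff.mul k ((hf.2 T hT).1 k) ((hg.2 T hT).1 k),
      HasModerateGrowth.mul (smooth_hasMulBounds n M) (hf.2 T hT).2 (hg.2 T hT).2⟩⟩
  add_mem' hf hg := ⟨fun k => IsFrechetC.add k (hf.1 k) (hg.1 k), fun T hT =>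
    ⟨fun k => NetDiff.add k ((hf.2 T hT).1 k) ((hg.2 T hT).1 k), (hf.2 T hT).2.add (hg.2 T hT).2⟩⟩
  algebraMap_mem' _ := ⟨fun k => IsFrechetC.const k _, fun _ _ =>
    ⟨NetSmooth.const _, HasModerateGrowth.const _⟩⟩

/-- The ideal `N_L(M)` of the maps that are negligible over `L`. -/
def negligibleMaps (L : Set (Net (SmoothingOp n M))) : Ideal (moderateMaps L) where
  carrier := {φ | ∀ T ∈ L, IsNegligible (fun ε => φ.1 (T ε))}
  zero_mem' := fun _ _ => ⟨NetSmooth.const _, HasRapidDecay.zero⟩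
  add_mem' hf hg := fun T hT =>
    ⟨fun k => NetDiff.add k ((hf T hT).1 k) ((hg T hT).1 k), (hf T hT).2.add (hg T hT).2⟩
  smul_mem' φ _ hg := fun T hT =>
    ⟨fun k => NetDiff.mul k ((φ.2.2 T hT).1 k) ((hg T hT).1 k),
      HasRapidDecay.mul (smooth_hasMulBounds n M) (φ.2.2 T hT).2 (hg T hT).2⟩

/-- The full algebra `𝒢_L(M) = E_L(M) / N_L(M)` of generalized functions over `L`. -/
abbrev GenAlg (L : Set (Net (SmoothingOp n M))) : Type u := moderateMaps L ⧸ negligibleMaps L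

/-- The class in `𝒢_L(M)` of a moderate map. -/
noncomputable def GenAlg.mk (L : Set (Net (SmoothingOp n M))) : moderateMaps L →ₐ[ℂ] GenAlg L :=
  Ideal.Quotient.mkₐ ℂ (negligibleMaps L)

/-- The action of a diffeomorphism on maps `φ : Ψ^{-∞}(M) → C^∞(M)`,
`(χ^* φ) T = χ^* (φ ((χ_*)⁻¹ T))`; here `(χ_*)⁻¹ = (χ⁻¹)_*`. -/
noncomputable def pullMap (χ : M ≃ₘ^∞⟮𝓡 n, 𝓡 n⟯ M) (φ : SmoothingOp n M → SmoothFun n M) :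
    SmoothingOp n M → SmoothFun n M :=
  fun T => pullFun χ (φ (pushOp χ.symm T))

/-- The map `Θ_u T = T u`. -/
noncomputable def theta (u : Distribution n M) : SmoothingOp n M →L[ℂ] SmoothFun n M where
  toFun T := T u
  map_add' _ _ := rfl
  map_smul' _ _ := rfl
  cont := continuous_eval_const u

theorem theta_mem {L : Set (Net (SmoothingOp n M))} (hL : L ⊆ approxUnits n M)
    (u : Distribution n M) : (theta u : SmoothingOp n M → SmoothFun n M) ∈ moderateMaps L :=
  ⟨IsFrechetSmooth.of_clm _, fun T hT =>
    ⟨NetSmooth.map_clm (theta u) (hL hT).moderate.1,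
      HasModerateGrowth.map_clm (theta u) (hL hT).moderate.2⟩⟩

/-- The embedding `u ↦ [Θ_u]` of distributions into `𝒢_L(M)`. -/
noncomputable def embedding (L : Set (Net (SmoothingOp n M))) (hL : L ⊆ approxUnits n M) :
    Distribution n M →ₗ[ℂ] GenAlg L where
  toFun u := GenAlg.mk L ⟨theta u, theta_mem hL u⟩
  map_add' u v := by
    rw [← map_add]
    congr 1
    exact Subtype.ext (funext fun T => map_add T u v)
  map_smul' c u := by
    rw [RingHom.id_apply, ← map_smul]
    congr 1
    exact Subtype.ext (funext fun T => map_smul T c u)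

end Integral

end Manifold

end GenFun

open GenFun

/-! Injectivity comes from testing against densities. If `Θ_u` is negligible over a nonempty `X`,
pick one `T` in `X`: then `T_ε u` decays rapidly in `C^∞(M)`, and since `f ↦ ∫ f η` is a continuous
functional (`pairing`), the numbers `⟨T_ε u, η⟩` tend to `0`. They also tend to `⟨u, η⟩` because `T`
is an approximate unit, so `u = 0`.

The rest is transport of structure. All pull backs are contravariant functors: with `χ.trans ψ`
standing for `ψ ∘ χ`, one has `χ^* ψ^* = (ψ ∘ χ)^*` on functions, densities, distributions,
operators and maps of operators. The identity `(χ^* φ)(χ_* T) = χ^*(φ T)` (`pullMap_push`) and the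
continuity of `χ^*` on `C^∞(M)` carry moderate and negligible maps over `X` to such maps over `χ_*
X`. Hence `χ^*` descends to the quotients, with inverse induced by `χ⁻¹`, and `χ^* Θ_u = Θ_{χ^* u}`
by cancellation.

The one analytic point is that `χ_*` preserves approximate units (`IsApproxUnit.push`). This
requires the inclusion of functions into distributions to commute with `χ^*` (`pullDist_toDist`),
that is, the invariance of `∫_M f η` under diffeomorphisms (`integralMul_pullFun`). As the integral
is defined by one chosen partition of unity in chosen charts, its independence of these choices is
proved on the way. -/

namespace GenFun

universe u v

/-! ### Smoothness and decay under continuous linear maps; the filter `ε → 0` -/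

section Calculus

variable {E : Type u} {F : Type v} [AddCommGroup E] [Module ℂ E] [TopologicalSpace E]
  [AddCommGroup F] [Module ℂ F] [TopologicalSpace F]

/-- Continuous linear maps commute with difference quotients and limits. The induction ranges over
all domains because the derivative lives on `E × E`. Together with `IsFrechetC.comp_clm` this gives
the smoothness of `χ^* φ`. -/
theorem IsFrechetC.clm_comp {G : Type v} [AddCommGroup G] [Module ℂ G] [TopologicalSpace G]
    (B : F →L[ℂ] G) (k : ℕ) : ∀ {E : Type u} [AddCommGroup E] [Module ℂ E] [TopologicalSpace E]
    {f : E → F}, IsFrechetC k f → IsFrechetC k (fun x => B (f x)) := by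
  induction k with
  | zero => intro E _ _ _ f h; exact B.continuous.comp h
  | succ k ih =>
    rintro E _ _ _ f ⟨hc, df, hd, hk⟩
    refine ⟨B.continuous.comp hc, _, fun x h => ?_, ih hk⟩
    refine ((B.continuous.tendsto _).comp (hd x h)).congr fun t => ?_
    simp

theorem HasRapidDecay.map_clm (A : E →L[ℂ] F) {c : Net E} (hc : HasRapidDecay c) :
    HasRapidDecay (fun ε => A (c ε)) :=
  fun ρ hρ => hc (ρ.comp A.toLinearMap) (hρ.comp A.continuous)

theorem HasRapidDecay.tendsto_zero {c : Net ℂ} (hc : HasRapidDecay c) :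
    Tendsto c (comap Subtype.val (𝓝 0)) (𝓝 0) := by
  -- Order `1` suffices: `C * ε` already tends to `0`.
  obtain ⟨C, hC, e, he, H⟩ := hc (normSeminorm ℂ ℂ) continuous_norm 1
  have h0 : Tendsto (fun ε : Ioo (0 : ℝ) 1 => C * (ε : ℝ)) (comap Subtype.val (𝓝 0)) (𝓝 0) := by
    simpa using (tendsto_comap (f := (Subtype.val : Ioo (0 : ℝ) 1 → ℝ)) (x := 𝓝 0)).const_mul C
  refine squeeze_zero_norm' ?_ h0
  have h1 : ∀ᶠ ε : Ioo (0 : ℝ) 1 in comap Subtype.val (𝓝 0), (ε : ℝ) < e :=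
    tendsto_comap.eventually (gt_mem_nhds he)
  filter_upwards [h1] with ε hε
  simpa using (H ε hε).le

/-- The point `0` is not in `(0,1)` but is a limit of it from the right. Without this, limits as `ε
→ 0` would not be unique. -/
theorem comap_val_neBot : (comap (Subtype.val : Ioo (0 : ℝ) 1 → ℝ) (𝓝 0)).NeBot := by
  refine comap_neBot_iff_frequently.2 ?_
  have h : ∃ᶠ x : ℝ in 𝓝[>] 0, x ∈ Ioo (0 : ℝ) 1 :=
    Eventually.frequently (Ioo_mem_nhdsGT one_pos)
  simpa using h.filter_mono nhdsWithin_le_nhds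

end Calculus

/-! ### Functoriality of the pull backs -/

section Manifold

variable {n : ℕ} {M : Type u} [TopologicalSpace M] [ChartedSpace (Model n) M]
  [IsManifold (𝓡 n) ∞ M]

section Pullback

variable (χ ψ : M ≃ₘ^∞⟮𝓡 n, 𝓡 n⟯ M)

/-- Both charts are `e ∘ ψ ∘ χ`; this is the source of the order reversal in all the composition
laws below. -/
theorem Chart.pull_pull (e : Chart n M) : (e.pull ψ).pull χ = e.pull (χ.trans ψ) :=
  Subtype.ext (OpenPartialHomeomorph.ext _ _ (fun _ => rfl) (fun _ => rfl) rfl)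

theorem Chart.pull_refl (e : Chart n M) : e.pull (Diffeomorph.refl (𝓡 n) M ∞) = e :=
  Subtype.ext (OpenPartialHomeomorph.ext _ _ (fun _ => rfl) (fun _ => rfl) rfl)

theorem pullFun_apply (f : SmoothFun n M) (x : M) : pullFun χ f x = f (χ x) := rfl

theorem SmoothFun.ext {f g : SmoothFun n M} (h : ∀ x, f x = g x) : f = g :=
  Subtype.ext (funext h)

theorem Density.ext {η θ : Density n M} (h : ∀ e, η.1 e = θ.1 e) : η = θ :=
  Subtype.ext (funext h)

theorem pullDensity_val (η : Density n M) (e : Chart n M) :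
    (pullDensity χ η).1 e = η.1 (e.pull χ.symm) := rfl

theorem pullDist_apply (u : Distribution n M) (η : Density n M) :
    pullDist χ u η = u (pullDensity χ.symm η) := rfl

theorem pushOp_apply (T : SmoothingOp n M) (u : Distribution n M) :
    pushOp χ T u = pullFun χ (T (pullDist χ.symm u)) := rfl

theorem pullMap_apply (φ : SmoothingOp n M → SmoothFun n M) (T : SmoothingOp n M) :
    pullMap χ φ T = pullFun χ (φ (pushOp χ.symm T)) := rfl

theorem diffeomorph_symm_symm : χ.symm.symm = χ := rfl

theorem diffeomorph_symm_trans : (χ.trans ψ).symm = ψ.symm.trans χ.symm := rfl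

theorem pullFun_pullFun (f : SmoothFun n M) :
    pullFun χ (pullFun ψ f) = pullFun (χ.trans ψ) f := SmoothFun.ext fun _ => by
  simp only [pullFun_apply, Diffeomorph.coe_trans, Function.comp_apply]

theorem pullDensity_pullDensity (η : Density n M) :
    pullDensity χ (pullDensity ψ η) = pullDensity (χ.trans ψ) η := Density.ext fun e => by
  rw [pullDensity_val, pullDensity_val, pullDensity_val, Chart.pull_pull, diffeomorph_symm_trans]

theorem pullDist_pullDist (u : Distribution n M) :
    pullDist χ (pullDist ψ u) = pullDist (χ.trans ψ) u := ContinuousLinearMap.ext fun η => by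
  rw [pullDist_apply, pullDist_apply, pullDist_apply, pullDensity_pullDensity,
    diffeomorph_symm_trans]

/-- Despite its notation `χ_*` is contravariant as well, since `χ^*` stands on the left of `T` and
`(χ⁻¹)^*` on the right. -/
theorem pushOp_pushOp (T : SmoothingOp n M) :
    pushOp χ (pushOp ψ T) = pushOp (χ.trans ψ) T := ContinuousLinearMap.ext fun u => by
  rw [pushOp_apply, pushOp_apply, pushOp_apply, pullDist_pullDist, pullFun_pullFun,
    diffeomorph_symm_trans]

theorem pullMap_pullMap (φ : SmoothingOp n M → SmoothFun n M) :
    pullMap χ (pullMap ψ φ) = pullMap (χ.trans ψ) φ := funext fun T => by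
  rw [pullMap_apply, pullMap_apply, pullMap_apply, pushOp_pushOp, pullFun_pullFun,
    diffeomorph_symm_trans]

theorem pullFun_refl (f : SmoothFun n M) : pullFun (Diffeomorph.refl (𝓡 n) M ∞) f = f :=
  SmoothFun.ext fun _ => rfl

theorem diffeomorph_refl_symm :
    (Diffeomorph.refl (𝓡 n) M ∞).symm = Diffeomorph.refl (𝓡 n) M ∞ := rfl

theorem pullDensity_refl (η : Density n M) : pullDensity (Diffeomorph.refl (𝓡 n) M ∞) η = η :=
  Density.ext fun e => by rw [pullDensity_val, diffeomorph_refl_symm, Chart.pull_refl]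

theorem pullDist_refl (u : Distribution n M) : pullDist (Diffeomorph.refl (𝓡 n) M ∞) u = u :=
  ContinuousLinearMap.ext fun η => by
    rw [pullDist_apply, diffeomorph_refl_symm, pullDensity_refl]

theorem pushOp_refl (T : SmoothingOp n M) : pushOp (Diffeomorph.refl (𝓡 n) M ∞) T = T :=
  ContinuousLinearMap.ext fun u => by
    rw [pushOp_apply, diffeomorph_refl_symm, pullDist_refl, pullFun_refl]

theorem pullMap_refl (φ : SmoothingOp n M → SmoothFun n M) :
    pullMap (Diffeomorph.refl (𝓡 n) M ∞) φ = φ :=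
  funext fun T => by rw [pullMap_apply, diffeomorph_refl_symm, pushOp_refl, pullFun_refl]

theorem pushOp_symm_pushOp (T : SmoothingOp n M) : pushOp χ.symm (pushOp χ T) = T := by
  rw [pushOp_pushOp, Diffeomorph.symm_trans_self, pushOp_refl]

theorem pullDensity_self_symm (η : Density n M) :
    pullDensity χ (pullDensity χ.symm η) = η := by
  rw [pullDensity_pullDensity, Diffeomorph.self_trans_symm, pullDensity_refl]

theorem pullFun_self_symm (f : SmoothFun n M) : pullFun χ (pullFun χ.symm f) = f := by
  rw [pullFun_pullFun, Diffeomorph.self_trans_symm, pullFun_refl]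

end Pullback

end Manifold

/-! ### Invariance of the integral of densities, and continuity of the pairing -/

section Integral

variable {n : ℕ} {M : Type u} [TopologicalSpace M] [ChartedSpace (Model n) M]
  [IsManifold (𝓡 n) ∞ M]

/-- The integral of `g η` over the image of the chart `e`. -/
noncomputable def chartIntegral (e : Chart n M) (η : Density n M) (g : M → ℂ) : ℂ :=
  ∫ y in e.1.target, g (e.1.symm y) * η.1 e y

/-- Since `g` vanishes off both chart domains, both integrals live on the overlap. There the change
of variables by the transition map produces the Jacobian factor that the transformation law of
densities absorbs. -/
theorem chartIntegral_congr_chart (e e' : Chart n M) (η : Density n M) {g : M → ℂ}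
    (h : ∀ p ∉ e.1.source, g p = 0) (h' : ∀ p ∉ e'.1.source, g p = 0) :
    chartIntegral e η g = chartIntegral e' η g := by
  set φ := e.1.symm.trans e'.1 with hφ
  have hs : MeasurableSet φ.source := φ.open_source.measurableSet
  have e1 : chartIntegral e η g = ∫ y in φ.source, g (e.1.symm y) * η.1 e y := by
    refine setIntegral_eq_of_subset_of_forall_sdiff_eq_zero e.1.open_target.measurableSet
      (fun y hy => hy.1) ?_
    rintro y ⟨hy, hy'⟩
    rw [h' (e.1.symm y) fun hy2 => hy' ⟨hy, hy2⟩, zero_mul]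
  have e2 : chartIntegral e' η g = ∫ y in φ.target, g (e'.1.symm y) * η.1 e' y := by
    refine setIntegral_eq_of_subset_of_forall_sdiff_eq_zero e'.1.open_target.measurableSet
      (fun y hy => hy.1) ?_
    rintro y ⟨hy, hy'⟩
    rw [h (e'.1.symm y) fun hy2 => hy' ⟨hy, hy2⟩, zero_mul]
  have hd : ContDiffOn ℝ ∞ φ φ.source := by
    refine contMDiffOn_iff_contDiffOn.1 ?_
    exact (contMDiffOn_of_mem_maximalAtlas e'.2).comp
      ((contMDiffOn_symm_of_mem_maximalAtlas e.2).mono fun y hy => hy.1) fun y hy => hy.2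
  have hd' : ∀ y ∈ φ.source, HasFDerivWithinAt φ (fderiv ℝ φ y) φ.source y := fun y hy =>
    ((hd.differentiableOn (by simp)).differentiableAt
      (φ.open_source.mem_nhds hy)).hasFDerivAt.hasFDerivWithinAt
  rw [e1, e2, ← φ.image_source_eq_target,
    integral_image_eq_integral_abs_det_fderiv_smul volume hs hd' φ.injOn]
  refine setIntegral_congr_fun hs fun y hy => ?_
  have hy2 : e'.1.symm (φ y) = e.1.symm y := e'.1.left_inv hy.2
  simp only [hy2]
  -- The law of densities, read from `e` to `e'`, supplies the same `|det|` as the change of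
  -- variables.
  rw [η.2.2.2 e e' y hy, Complex.real_smul]
  ring

/-- No change of variables is needed: `e` and `e ∘ χ` have the same image, and the coefficient of
`(χ⁻¹)^* η` in `e` is by definition that of `η` in `e ∘ χ`. The integrands agree pointwise. -/
theorem chartIntegral_pull (χ : M ≃ₘ^∞⟮𝓡 n, 𝓡 n⟯ M) (e : Chart n M) (η : Density n M)
    (g : M → ℂ) :
    chartIntegral e (pullDensity χ.symm η) g = chartIntegral (e.pull χ) η (fun p => g (χ p)) := by
  have h : ∀ y, χ ((e.pull χ).1.symm y) = e.1.symm y := fun y => χ.apply_symm_apply _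
  simp only [chartIntegral, h]
  rfl

variable [CompactSpace M] [T2Space M]

/-- The integrand is continuous on the compact image of the support of `g` and zero elsewhere in the
target. Compactness of `M` enters here; the result justifies splitting integrals of finite sums. -/
theorem integrableOn_chart (e : Chart n M) (η : Density n M) {g : M → ℂ} (hg : Continuous g)
    (hs : tsupport g ⊆ e.1.source) :
    IntegrableOn (fun y => g (e.1.symm y) * η.1 e y) e.1.target := by
  have hK : IsCompact (e.1 '' tsupport g) :=
    (isClosed_tsupport g).isCompact.image_of_continuousOn (e.1.continuousOn.mono hs)
  have hKt : e.1 '' tsupport g ⊆ e.1.target := by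
    rintro _ ⟨z, hz, rfl⟩
    exact e.1.map_source (hs hz)
  have h1 : IntegrableOn (fun y => g (e.1.symm y) * η.1 e y) (e.1 '' tsupport g) :=
    ((hg.comp_continuousOn (e.1.continuousOn_symm.mono hKt)).mul
      ((η.2.1 e).continuousOn.mono hKt)).integrableOn_compact hK
  refine h1.of_forall_sdiff_eq_zero e.1.open_target.measurableSet ?_
  rintro y ⟨hy, hy'⟩
  have : g (e.1.symm y) = 0 := by
    by_contra h
    exact hy' ⟨_, subset_tsupport _ h, e.1.right_inv hy⟩
  rw [this, zero_mul]

theorem chartIntegral_sum {ι : Type*} (s : Finset ι) (e : Chart n M) (η : Density n M)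
    {g : ι → M → ℂ} (hg : ∀ i, Continuous (g i)) (hs : ∀ i, tsupport (g i) ⊆ e.1.source) :
    chartIntegral e η (fun p => ∑ i ∈ s, g i p) = ∑ i ∈ s, chartIntegral e η (g i) := by
  simp only [chartIntegral, Finset.sum_mul]
  exact integral_finsetSum _ fun i _ => integrableOn_chart e η (hg i) (hs i)

variable (n M) in
/-- The finite set of indices of the nonzero members of the chosen partition of unity. -/
noncomputable def partitionIndices : Finset M := (finite_partition n M).toFinset

theorem sum_partition (p : M) :
    ∑ x ∈ partitionIndices n M, ((chosenPartition n M x p : ℝ) : ℂ) = 1 := by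
  have h := (chosenPartition n M).sum_eq_one (mem_univ p)
  rw [finsum_eq_sum_of_support_subset (s := partitionIndices n M)] at h
  · exact_mod_cast h
  · intro x hx
    simp only [partitionIndices, Finite.coe_toFinset, mem_ofPred_eq]
    exact ⟨p, hx⟩

theorem integralMul_eq_sum_chartIntegral (f : SmoothFun n M) (η : Density n M) :
    integralMul f η = ∑ x ∈ partitionIndices n M, chartIntegral (chartAtlas x) η
      (fun p => ((chosenPartition n M x p : ℝ) : ℂ) * f p) := by
  rw [integralMul_eq]
  refine Finset.sum_congr rfl fun x _ => ?_
  change integralTerm f η x = _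
  simp only [integralTerm, chartIntegral, mul_assoc]

theorem SmoothFun.continuous_coe (f : SmoothFun n M) : Continuous (fun p => f p) :=
  (show ContMDiff (𝓡 n) 𝓘(ℝ, ℂ) ∞ f.1 from f.2).continuous

theorem continuous_partition (x : M) :
    Continuous fun p => ((chosenPartition n M x p : ℝ) : ℂ) :=
  Complex.continuous_ofReal.comp (chosenPartition n M x).contMDiff.continuous

theorem tsupport_partition_subset (x : M) :
    tsupport (fun p => ((chosenPartition n M x p : ℝ) : ℂ)) ⊆
      (chartAtlas (n := n) x).1.source :=
  (tsupport_comp_subset Complex.ofReal_zero _).trans (chosenPartition_subordinate n M x)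

theorem eq_zero_of_tsupport_subset {g : M → ℂ} {s : Set M} (h : tsupport g ⊆ s) {p : M}
    (hp : p ∉ s) : g p = 0 := by
  by_contra h0
  exact hp (h (subset_tsupport _ h0))

/-- The integral of densities is invariant under diffeomorphisms. -/
theorem integralMul_pullFun (χ : M ≃ₘ^∞⟮𝓡 n, 𝓡 n⟯ M) (f : SmoothFun n M) (η : Density n M) :
    integralMul (pullFun χ f) η = integralMul f (pullDensity χ.symm η) := by
  set ρ : M → M → ℂ := fun x p => ((chosenPartition n M x p : ℝ) : ℂ) with hρ
  have hχ : Continuous χ := χ.contMDiff.continuous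
  -- The chosen partition is refined by its own pull back: `g z x` is supported both in the chart at
  -- `z` and in the chart at `x` composed with `χ`. Both sides become the double sum of the
  -- integrals of the `g z x`.
  set g : M → M → M → ℂ := fun z x p => ρ z p * (ρ x (χ p) * f (χ p)) with hg
  have gc : ∀ z x, Continuous (g z x) := fun z x => (continuous_partition z).mul
    (((continuous_partition x).comp hχ).mul (f.continuous_coe.comp hχ))
  have g1 : ∀ z x, tsupport (g z x) ⊆ (chartAtlas (n := n) z).1.source := fun z x =>
    (tsupport_mul_subset_left).trans (tsupport_partition_subset z)
  have g2 : ∀ z x, tsupport (g z x) ⊆ ((chartAtlas (n := n) x).pull χ).1.source := by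
    intro z x
    refine tsupport_mul_subset_right.trans (tsupport_mul_subset_left.trans ?_)
    refine (tsupport_comp_subset_preimage (ρ x) hχ).trans ?_
    exact preimage_mono (tsupport_partition_subset x)
  rw [integralMul_eq_sum_chartIntegral, integralMul_eq_sum_chartIntegral]
  -- Left side: insert `∑ₓ ρ x ∘ χ = 1`.
  have e1 : ∀ z, chartIntegral (chartAtlas z) η (fun p => ρ z p * pullFun χ f p) =
      ∑ x ∈ partitionIndices n M, chartIntegral (chartAtlas z) η (g z x) := by
    intro z
    rw [← chartIntegral_sum _ _ _ (gc z) (g1 z)]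
    congr 1
    funext p
    rw [← Finset.mul_sum, ← Finset.sum_mul, sum_partition, one_mul, pullFun_apply]
  -- Right side: pass to the pulled back chart, insert `∑_z ρ z = 1`, and move each piece to the
  -- chart at `z`.
  have e2 : ∀ x, chartIntegral (chartAtlas x) (pullDensity χ.symm η) (fun p => ρ x p * f p) =
      ∑ z ∈ partitionIndices n M, chartIntegral (chartAtlas z) η (g z x) := by
    intro x
    rw [chartIntegral_pull]
    have e3 : ∀ z, chartIntegral (chartAtlas z) η (g z x) =
        chartIntegral ((chartAtlas x).pull χ) η (g z x) := fun z =>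
      chartIntegral_congr_chart _ _ _ (fun p hp => eq_zero_of_tsupport_subset (g1 z x) hp)
        (fun p hp => eq_zero_of_tsupport_subset (g2 z x) hp)
    simp only [e3]
    rw [← chartIntegral_sum _ _ _ (fun z => gc z x) (fun z => g2 z x)]
    congr 1
    funext p
    rw [← Finset.sum_mul, sum_partition, one_mul]
  rw [Finset.sum_congr rfl fun z _ => e1 z, Finset.sum_congr rfl fun x _ => e2 x,
    Finset.sum_comm]

theorem pullDist_toDist (χ : M ≃ₘ^∞⟮𝓡 n, 𝓡 n⟯ M) (f : SmoothFun n M) :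
    pullDist χ f.toDist = (pullFun χ f).toDist :=
  ContinuousLinearMap.ext fun η => (integralMul_pullFun χ f η).symm

/-- The pairing of smooth functions with a fixed density, over one chart. -/
noncomputable def termLinearFun (η : Density n M) (x : M) : SmoothFun n M →ₗ[ℂ] ℂ where
  toFun f := integralTerm f η x
  map_add' a b := by
    rw [integralTerm_eq, integralTerm_eq, integralTerm_eq,
      ← integral_add (integrableOn_term a η x) (integrableOn_term b η x)]
    congr 1; ext y
    change _ * ((a _ + b _) * _) = _
    ring
  map_smul' c a := by
    rw [integralTerm_eq, integralTerm_eq, RingHom.id_apply, smul_eq_mul, ← integral_const_mul]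
    congr 1; ext y
    change _ * ((c * a _) * _) = _
    ring

/-- On the compact `K` carrying the integrand, the integral is at most `sup |ρ η| * vol K * sup
|f|`, and the last factor is the order `0` seminorm of `supportIndex x`. -/
theorem continuous_termLinearFun (η : Density n M) (x : M) : Continuous (termLinearFun η x) := by
  have hK := (supportIndex (n := n) x).isCompact
  have hsymm := (chartAtlas (n := n) x).1.continuousOn_symm.mono (supportIndex (n := n) x).subset
  obtain ⟨C, hC⟩ := hK.exists_bound_of_continuousOn
    (((continuous_partition (n := n) x).comp_continuousOn hsymm).mul (continuousOn_coeff η x))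
  set V := volume.real (supportIndex (n := n) x).K
  refine WithSeminorms.continuous_normedSpace_rng ℂ (smooth_withSeminorms n M) _
    -- The bound `C` can be negative when `K` is empty, hence `|C|`.
    ⟨{supportIndex x}, Real.toNNReal (|C| * V), fun f => ?_⟩
  simp only [Finset.sup_singleton]
  change ‖integralTerm f η x‖ ≤ ((Real.toNNReal (|C| * V) : NNReal) : ℝ) *
    smoothFamily n M (supportIndex x) f
  rw [Real.coe_toNNReal _ (mul_nonneg (abs_nonneg _) measureReal_nonneg), integralTerm_eq]
  have hb : ∀ y ∈ (supportIndex (n := n) x).K, ‖f ((chartAtlas (n := n) x).1.symm y)‖ ≤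
      smoothFamily n M (supportIndex x) f := by
    intro y hy
    have hbd : BddAbove (range fun y : (supportIndex (n := n) x).K =>
        ‖iteratedFDerivWithin ℝ 0 (SmoothFun.rep (chartAtlas x) f)
          (chartAtlas (n := n) x).1.target y‖) := by
      have := hK.bddAbove_image (ContinuousOn.norm
        ((SmoothFun.rep_contDiffOn (chartAtlas x) f).continuousOn.mono (supportIndex x).subset))
      rw [image_eq_range] at this
      simpa only [norm_iteratedFDerivWithin_zero] using this
    have := le_ciSup hbd ⟨y, hy⟩
    rw [norm_iteratedFDerivWithin_zero] at this
    exact this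
  refine (norm_setIntegral_le_of_norm_le_const (C := |C| * smoothFamily n M (supportIndex x) f)
    hK.measure_lt_top fun y hy => ?_).trans (le_of_eq (by ring))
  rw [mul_left_comm, mul_comm, norm_mul]
  exact mul_le_mul ((hC y hy).trans (le_abs_self C)) (hb y hy) (norm_nonneg _) (abs_nonneg _)

/-- The pairing `f ↦ ∫_M f η` with a fixed density. -/
noncomputable def pairing (η : Density n M) : SmoothFun n M →L[ℂ] ℂ where
  toLinearMap := ∑ x ∈ (finite_partition n M).toFinset, termLinearFun η x
  cont := by
    change Continuous (⇑(∑ x ∈ (finite_partition n M).toFinset, termLinearFun η x))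
    simp only [LinearMap.coe_sum, Finset.sum_fn]
    exact continuous_finsetSum _ fun x _ => continuous_termLinearFun η x

theorem pairing_apply (η : Density n M) (f : SmoothFun n M) : pairing η f = f.toDist η := by
  change (∑ x ∈ (finite_partition n M).toFinset, termLinearFun η x) f = integralMul f η
  rw [integralMul_eq, LinearMap.sum_apply]
  rfl

end Integral

/-! ### Action on approximate units and on the algebras of generalized functions -/

section Algebra

variable {n : ℕ} {M : Type u} [TopologicalSpace M] [ChartedSpace (Model n) M]
  [IsManifold (𝓡 n) ∞ M]

/-- The action of a diffeomorphism on smoothing operators, as a continuous linear map. -/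
noncomputable def pushOpCLM (χ : M ≃ₘ^∞⟮𝓡 n, 𝓡 n⟯ M) : SmoothingOp n M →L[ℂ] SmoothingOp n M :=
  (ContinuousLinearMap.postcomp (Distribution n M) (pullFun χ)).comp
    (ContinuousLinearMap.precomp (SmoothFun n M) (pullDist χ.symm))

theorem pushOpCLM_apply (χ : M ≃ₘ^∞⟮𝓡 n, 𝓡 n⟯ M) (T : SmoothingOp n M) :
    pushOpCLM χ T = pushOp χ T := rfl

variable [CompactSpace M] [T2Space M]

/-- Moderateness passes through the continuous linear map `χ_*`. For the two limits, apply the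
hypotheses on `T` to `(χ⁻¹)^* u`, `(χ⁻¹)^* η` and `(χ⁻¹)^* f`, and move `χ^*` across the pairing by
`pullDist_toDist`. -/
theorem IsApproxUnit.push {T : Net (SmoothingOp n M)} (hT : IsApproxUnit T)
    (χ : M ≃ₘ^∞⟮𝓡 n, 𝓡 n⟯ M) : IsApproxUnit (fun ε => pushOp χ (T ε)) where
  moderate := by
    simp only [← pushOpCLM_apply]
    exact ⟨NetSmooth.map_clm (E := SmoothingOp n M) (F := SmoothingOp n M) (pushOpCLM χ)
      hT.moderate.1, HasModerateGrowth.map_clm (E := SmoothingOp n M) (F := SmoothingOp n M)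
      (pushOpCLM χ) hT.moderate.2⟩
  tendsto u η := by
    have h := hT.tendsto (pullDist χ.symm u) (pullDensity χ.symm η)
    rw [pullDist_apply, diffeomorph_symm_symm, pullDensity_self_symm] at h
    refine h.congr fun ε => ?_
    rw [pushOp_apply, ← pullDist_toDist, pullDist_apply]
  rapid f := by
    -- With `g = (χ⁻¹)^* f` one has `(χ_* T) f - f = χ^*(T g - g)`.
    have h := (hT.rapid (pullFun χ.symm f)).map_clm (pullFun χ)
    convert h using 2 with ε
    rw [map_sub, pullFun_self_symm, pushOp_apply, pullDist_toDist]

theorem pushSet_subset {X : Set (Net (SmoothingOp n M))} (hX : X ⊆ approxUnits n M)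
    (χ : M ≃ₘ^∞⟮𝓡 n, 𝓡 n⟯ M) : pushSet χ X ⊆ approxUnits n M := by
  rintro _ ⟨T, hT, rfl⟩
  exact (hX hT).push χ

theorem pushSet_pushSet (χ ψ : M ≃ₘ^∞⟮𝓡 n, 𝓡 n⟯ M) (X : Set (Net (SmoothingOp n M))) :
    pushSet χ (pushSet ψ X) = pushSet (χ.trans ψ) X := by
  simp only [pushSet, image_image, pushOp_pushOp]

theorem pushSet_refl (X : Set (Net (SmoothingOp n M))) :
    pushSet (Diffeomorph.refl (𝓡 n) M ∞) X = X := by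
  simp only [pushSet, pushOp_refl, image_id']

theorem pushSet_symm {χ : M ≃ₘ^∞⟮𝓡 n, 𝓡 n⟯ M} {X Y : Set (Net (SmoothingOp n M))}
    (h : pushSet χ X = Y) : pushSet χ.symm Y = X := by
  rw [← h, pushSet_pushSet, Diffeomorph.symm_trans_self, pushSet_refl]

/-- This reduces a growth condition on `χ^* φ` along a net of `χ_* X` to the one on `φ` along the
original net of `X`. -/
theorem pullMap_push (χ : M ≃ₘ^∞⟮𝓡 n, 𝓡 n⟯ M) (φ : SmoothingOp n M → SmoothFun n M)
    (T : SmoothingOp n M) : pullMap χ φ (pushOp χ T) = pullFun χ (φ T) := by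
  rw [pullMap_apply, pushOp_symm_pushOp]

/-- The target set is a variable `Y` with an equation, so that `Y = χ_* X` and, for invariant `X`,
`Y = X` are covered by one construction without transport along equalities. -/
theorem pullMap_mem {χ : M ≃ₘ^∞⟮𝓡 n, 𝓡 n⟯ M} {X Y : Set (Net (SmoothingOp n M))}
    (h : pushSet χ X = Y) (φ : moderateMaps X) : pullMap χ φ ∈ moderateMaps Y := by
  subst h
  have hφ : pullMap χ φ.1 = fun T => pullFun χ (φ.1 (pushOpCLM χ.symm T)) := funext fun T => by
    rw [pullMap_apply, pushOpCLM_apply]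
  refine ⟨fun k => ?_, ?_⟩
  · rw [hφ]
    exact (IsFrechetC.comp_clm k (E := SmoothingOp n M) (E' := SmoothingOp n M)
      (pushOpCLM χ.symm) (φ.2.1 k)).clm_comp (pullFun χ) k
  rintro _ ⟨T, hT, rfl⟩
  simp only [pullMap_push]
  exact ⟨(φ.2.2 T hT).1.map_clm (pullFun χ), (φ.2.2 T hT).2.map_clm (pullFun χ)⟩

/-- The pull back of moderate maps. -/
noncomputable def pullModerate (χ : M ≃ₘ^∞⟮𝓡 n, 𝓡 n⟯ M) {X Y : Set (Net (SmoothingOp n M))}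
    (h : pushSet χ X = Y) : moderateMaps X →ₐ[ℂ] moderateMaps Y where
  toFun φ := ⟨pullMap χ φ, pullMap_mem h φ⟩
  map_one' := rfl
  map_mul' _ _ := rfl
  map_zero' := rfl
  map_add' _ _ := rfl
  commutes' _ := rfl

theorem pullModerate_val (χ : M ≃ₘ^∞⟮𝓡 n, 𝓡 n⟯ M) {X Y : Set (Net (SmoothingOp n M))}
    (h : pushSet χ X = Y) (φ : moderateMaps X) : (pullModerate χ h φ).1 = pullMap χ φ.1 := rfl

theorem pullModerate_mem {χ : M ≃ₘ^∞⟮𝓡 n, 𝓡 n⟯ M} {X Y : Set (Net (SmoothingOp n M))}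
    (h : pushSet χ X = Y) {φ : moderateMaps X} (hφ : φ ∈ negligibleMaps X) :
    pullModerate χ h φ ∈ negligibleMaps Y := by
  subst h
  rintro _ ⟨T, hT, rfl⟩
  change IsNegligible (fun ε => pullMap χ φ.1 (pushOp χ (T ε)))
  simp only [pullMap_push]
  exact ⟨(hφ T hT).1.map_clm (pullFun χ), (hφ T hT).2.map_clm (pullFun χ)⟩

/-- The homomorphism `χ^* : 𝒢_X → 𝒢_{χ_* X}`. -/
noncomputable def pullHom (χ : M ≃ₘ^∞⟮𝓡 n, 𝓡 n⟯ M) {X Y : Set (Net (SmoothingOp n M))}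
    (h : pushSet χ X = Y) : GenAlg X →ₐ[ℂ] GenAlg Y :=
  Ideal.quotientMapₐ (negligibleMaps Y) (pullModerate χ h) fun _ hφ => pullModerate_mem h hφ

theorem pullHom_mk (χ : M ≃ₘ^∞⟮𝓡 n, 𝓡 n⟯ M) {X Y : Set (Net (SmoothingOp n M))}
    (h : pushSet χ X = Y) (φ : moderateMaps X) :
    pullHom χ h (GenAlg.mk X φ) = GenAlg.mk Y (pullModerate χ h φ) := rfl

theorem GenAlg.mk_surjective (X : Set (Net (SmoothingOp n M))) :
    Function.Surjective (GenAlg.mk X) := Ideal.Quotient.mkₐ_surjective ℂ _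

theorem pullHom_pullHom (χ ψ : M ≃ₘ^∞⟮𝓡 n, 𝓡 n⟯ M) {X Y Z : Set (Net (SmoothingOp n M))}
    (h : pushSet ψ X = Y) (h' : pushSet χ Y = Z) (h'' : pushSet (χ.trans ψ) X = Z)
    (a : GenAlg X) : pullHom χ h' (pullHom ψ h a) = pullHom (χ.trans ψ) h'' a := by
  obtain ⟨φ, rfl⟩ := GenAlg.mk_surjective X a
  rw [pullHom_mk, pullHom_mk, pullHom_mk]
  refine congrArg (GenAlg.mk Z) (Subtype.ext ?_)
  rw [pullModerate_val, pullModerate_val, pullModerate_val, pullMap_pullMap]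

/-- The equation `hχ` lets the lemma apply to composites such as `χ.symm.trans χ` without rewriting
inside `h`, whose statement depends on `χ`. -/
theorem pullHom_of_eq_refl {χ : M ≃ₘ^∞⟮𝓡 n, 𝓡 n⟯ M} {X : Set (Net (SmoothingOp n M))}
    (h : pushSet χ X = X) (hχ : χ = Diffeomorph.refl (𝓡 n) M ∞) (a : GenAlg X) :
    pullHom χ h a = a := by
  subst hχ
  obtain ⟨φ, rfl⟩ := GenAlg.mk_surjective X a
  rw [pullHom_mk]
  refine congrArg (GenAlg.mk X) (Subtype.ext ?_)
  rw [pullModerate_val, pullMap_refl]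

theorem pullHom_symm_pullHom {χ : M ≃ₘ^∞⟮𝓡 n, 𝓡 n⟯ M} {X Y : Set (Net (SmoothingOp n M))}
    (h : pushSet χ X = Y) (a : GenAlg X) :
    pullHom χ.symm (pushSet_symm h) (pullHom χ h a) = a := by
  have h2 : pushSet (χ.symm.trans χ) X = X := by
    rw [← pushSet_pushSet, h, pushSet_symm h]
  rw [pullHom_pullHom χ.symm χ h (pushSet_symm h) h2]
  exact pullHom_of_eq_refl h2 χ.symm_trans_self a

/-- The isomorphism `χ^* : 𝒢_X → 𝒢_{χ_* X}`. -/
noncomputable def pullEquiv (χ : M ≃ₘ^∞⟮𝓡 n, 𝓡 n⟯ M) {X Y : Set (Net (SmoothingOp n M))}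
    (h : pushSet χ X = Y) : GenAlg X ≃ₐ[ℂ] GenAlg Y :=
  AlgEquiv.ofAlgHom (pullHom χ h) (pullHom χ.symm (pushSet_symm h))
    (AlgHom.ext fun a => pullHom_symm_pullHom (pushSet_symm h) a)
    (AlgHom.ext fun a => pullHom_symm_pullHom h a)

theorem pullEquiv_symm (χ : M ≃ₘ^∞⟮𝓡 n, 𝓡 n⟯ M) {X Y : Set (Net (SmoothingOp n M))}
    (h : pushSet χ X = Y) : (pullEquiv χ h).symm = pullEquiv χ.symm (pushSet_symm h) :=
  AlgEquiv.ext fun _ => rfl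

/-- In `χ^* ((χ⁻¹)^* (T (χ^* u)))` the outer two pull backs cancel. -/
theorem pullMap_theta (χ : M ≃ₘ^∞⟮𝓡 n, 𝓡 n⟯ M) (u : Distribution n M) :
    pullMap χ (theta u) = theta (pullDist χ u) := funext fun T => by
  change pullFun χ (pushOp χ.symm T u) = T (pullDist χ u)
  rw [pushOp_apply, pullFun_self_symm, diffeomorph_symm_symm]

theorem pullEquiv_embedding (χ : M ≃ₘ^∞⟮𝓡 n, 𝓡 n⟯ M) {X Y : Set (Net (SmoothingOp n M))}
    (h : pushSet χ X = Y) (hX : X ⊆ approxUnits n M) (hY : Y ⊆ approxUnits n M)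
    (u : Distribution n M) :
    pullEquiv χ h (embedding X hX u) = embedding Y hY (pullDist χ u) := by
  change GenAlg.mk Y (pullModerate χ h ⟨theta u, theta_mem hX u⟩) =
    GenAlg.mk Y ⟨theta (pullDist χ u), theta_mem hY _⟩
  exact congrArg (GenAlg.mk Y) (Subtype.ext (pullMap_theta χ u))

/-- A single net of `X` suffices: `⟨T_ε u, η⟩` tends both to `u η` and to `0`. -/
theorem embedding_injective {X : Set (Net (SmoothingOp n M))} (hX : X ⊆ approxUnits n M)
    (hne : X.Nonempty) : Function.Injective (embedding X hX) := by
  refine (injective_iff_map_eq_zero _).2 fun u hu => ?_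
  obtain ⟨T, hT⟩ := hne
  have h1 : (⟨theta u, theta_mem hX u⟩ : moderateMaps X) ∈ negligibleMaps X :=
    Ideal.Quotient.eq_zero_iff_mem.1 hu
  have h2 : HasRapidDecay (fun ε => T ε u) := (h1 T hT).2
  refine ContinuousLinearMap.ext fun η => ?_
  have h3 := (h2.map_clm (pairing η)).tendsto_zero
  simp only [pairing_apply] at h3
  have := comap_val_neBot
  exact tendsto_nhds_unique ((hX hT).tendsto u η) h3

end Algebra

end GenFun

theorem mainTheorem2 {n : ℕ} {M : Type*} [TopologicalSpace M]
    [ChartedSpace (EuclideanSpace ℝ (Fin n)) M] [IsManifold (𝓡 n) ∞ M]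
    [CompactSpace M] [T2Space M]
    (X : Set (Net (SmoothingOp n M))) (hX : X ⊆ approxUnits n M) :
    -- distributions are embedded into the algebra over `X`
    (X.Nonempty → Function.Injective (embedding X hX)) ∧
    -- every diffeomorphism induces an isomorphism from the algebra over `X` to the one over `χ_* X`
    (∀ χ : M ≃ₘ^∞⟮𝓡 n, 𝓡 n⟯ M,
      ∃ (hχ : pushSet χ X ⊆ approxUnits n M) (A : GenAlg X ≃ₐ[ℂ] GenAlg (pushSet χ X)),
        (∀ φ : moderateMaps X, ∃ h : pullMap χ φ ∈ moderateMaps (pushSet χ X),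
          A (GenAlg.mk X φ) = GenAlg.mk (pushSet χ X) ⟨pullMap χ φ, h⟩) ∧
        ∀ u : Distribution n M, A (embedding X hX u) = embedding (pushSet χ X) hχ (pullDist χ u)) ∧
    -- the diffeomorphisms that leave `X` invariant act on the algebra over `X`
    (∃ act : {χ : M ≃ₘ^∞⟮𝓡 n, 𝓡 n⟯ M // pushSet χ X = X} → (GenAlg X ≃ₐ[ℂ] GenAlg X),
      (∀ χ, ∀ φ : moderateMaps X, ∃ h : pullMap χ.1 φ ∈ moderateMaps X,
        act χ (GenAlg.mk X φ) = GenAlg.mk X ⟨pullMap χ.1 φ, h⟩) ∧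
      (∃ h : pushSet (Diffeomorph.refl (𝓡 n) M ∞) X = X, act ⟨_, h⟩ = AlgEquiv.refl) ∧
      (∀ χ ψ, ∃ h : pushSet (χ.1.trans ψ.1) X = X, act ⟨_, h⟩ = (act ψ).trans (act χ)) ∧
      (∀ χ, ∃ h : pushSet χ.1.symm X = X, act ⟨_, h⟩ = (act χ).symm) ∧
      ∀ χ, ∀ u : Distribution n M,
        act χ (embedding X hX u) = embedding X hX (pullDist χ.1 u)) := by
  refine ⟨embedding_injective hX, fun χ => ⟨pushSet_subset hX χ, pullEquiv χ rfl,
    fun φ => ⟨pullMap_mem rfl φ, rfl⟩, fun u => pullEquiv_embedding χ rfl hX _ u⟩,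
    fun χ => pullEquiv χ.1 χ.2, fun χ φ => ⟨pullMap_mem χ.2 φ, rfl⟩,
    ⟨pushSet_refl X, AlgEquiv.ext fun a => pullHom_of_eq_refl _ rfl a⟩, fun χ ψ => ?_,
    fun χ => ⟨pushSet_symm χ.2, (pullEquiv_symm χ.1 χ.2).symm⟩,
    fun χ u => pullEquiv_embedding χ.1 χ.2 hX hX u⟩
  -- `χ.trans ψ` is `ψ ∘ χ`, whose action is that of `ψ` followed by that of `χ`: a right action.
  have h : pushSet (χ.1.trans ψ.1) X = X := by rw [← pushSet_pushSet, ψ.2, χ.2]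
  exact ⟨h, AlgEquiv.ext fun a => (pullHom_pullHom χ.1 ψ.1 ψ.2 χ.2 h a).symm⟩
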